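/- Let $\Sigma\subset\mathbb{R}^n$ be a closed (as a subset), boundaryless smooth submanifold of codimension $d$, with normal spaces $N_\xi(\Sigma)$. Let $\epsilon:\Sigma\to(0,\infty)$ be continuous and such that every point $x$ of $\Sigma^\epsilon=\{x\in\mathbb{R}^n:\|x-\xi\|<\epsilon(\xi)\text{ for some }\xi\in\Sigma\}$ has a unique closest point $\pi(x)\in\Sigma$, and $\pi:\Sigma^\epsilon\to\Sigma$ is a smooth submersion. Let $\{U_\nu\}_{\nu\in\mathbb{N}}$ be bounded open subsets of $\Sigma^\epsilon$, each meeting $\Sigma$, with $\Sigma\subset\bigcup_\nu U_\nu$, and such that for every $\nu$ there are fixed smooth vector fields $\mathbf{n}^\nu_1,\dots,\mathbf{n}^\nu_d$ on $\Sigma\cap U_\nu$ forming an orthonormal basis of $N_\xi(\Sigma)$ at each $\xi\in\Sigma\cap U_\nu$, and a number $\rho_\nu>0$ such that $(\xi,\omega,\rho)\mapsto\xi+\rho\sum_{k=1}^d\omega_k\mathbf{n}^\nu_k(\xi)$ is a diffeomorphism from $(\Sigma\cap U_\nu)\times\mathbb{S}^{d-1}\times(0,\rho_\nu)$ onto $U_\nu\setminus\Sigma$.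 For $x\in U_\nu\setminus\Sigma$ let $(\xi_x,\omega_x,\rho_x)$ be the corresponding tubular coordinates: $\xi_x=\pi(x)$, $\rho_x=\|x-\pi(x)\|$, $\omega_{x,k}=\mathbf{n}^\nu_k(\pi(x))\cdot(x-\pi(x))/\|x-\pi(x)\|$. Let $\Omega\subset\mathbb{R}^n$ be open with $\Omega\cap\Sigma\neq\emptyset$, let $K\subset\Omega$ be compact and let $m\in\mathbb{Z}$. Let $\mathcal{D}^{[m;K]}_{*,\Sigma}(\Omega)$ be the space of all (real- or complex-valued) $\phi\in C^\infty(\Omega\setminus\Sigma)$ that vanish outside $K$ and admit, on each nonempty $\Omega\cap U_\nu\setminus\Sigma$, a uniform strong asymptotic expansion $$\phi(x)\sim\sum_{j=m}^\infty a_j(\xi_x,\omega_x)\,\rho_x^j\qquad\text{as }\rho_x\to0$$ with some $a_j=a_j^{\phi,\nu}\in C^\infty((\Sigma\cap U_\nu)\times\mathbb{S}^{d-1})$; that is, for every multi-index $\beta\in\mathbb{N}^n$ and every integer $N\ge m$ there are $C$ and $\delta>0$ such that $$\Big|\partial_x^\beta\phi(x)-\sum_{j=m}^{N-1}\partial_x^\beta\big(a_j(\xi_x,\omega_x)\rho_x^j\big)\Big|\le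 C\rho_x^{N-|\beta|}\qquad\text{for all }x\in\Omega\cap U_\nu\setminus\Sigma\text{ with }\rho_x<\delta.$$ Then, for every multi-index $\alpha\in\mathbb{N}^n$, the operator $(\partial/\partial x)^\alpha$ maps $\mathcal{D}^{[m;K]}_{*,\Sigma}(\Omega)$ into $\mathcal{D}^{[m-|\alpha|;K]}_{*,\Sigma}(\Omega)$. -/

import Mathlib

open scoped ContDiff Topology

namespace Thick

/-- Euclidean space `ℝⁿ`. -/
abbrev Euc (n : ℕ) : Type := EuclideanSpace ℝ (Fin n)

section Manifolds

variable {E F : Type*} [NormedAddCommGroup E] [NormedSpace ℝ E]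
  [NormedAddCommGroup F] [NormedSpace ℝ F]

/-- A map is smooth on an arbitrary subset `S` of a normed space if, near each point of `S`, it
agrees on `S` with a smooth map defined on an open set. (For `S` a submanifold, or a product of
submanifolds, this is the usual notion of a smooth map on a manifold.) -/
def SmoothOnSet (f : E → F) (S : Set E) : Prop :=
  ∀ x ∈ S, ∃ V : Set E, IsOpen V ∧ x ∈ V ∧
    ∃ g : E → F, ContDiffOn ℝ ∞ g V ∧ ∀ y ∈ S ∩ V, f y = g y

/-- `f` restricts to a diffeomorphism from the subset `S` onto the subset `T`. -/
def IsDiffeoOn (f : E → F) (S : Set E) (T : Set F) : Prop :=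
  Set.BijOn f S T ∧ SmoothOnSet f S ∧
    ∃ g : F → E, SmoothOnSet g T ∧ ∀ x ∈ S, g (f x) = x

end Manifolds

/-- `S` is a smooth (embedded, boundaryless) `k`-dimensional submanifold of `ℝⁿ`: every point
of `S` has a relatively open neighbourhood in `S` diffeomorphic to an open subset of `ℝᵏ`. -/
def IsSubmanifold {n : ℕ} (k : ℕ) (S : Set (Euc n)) : Prop :=
  ∀ x ∈ S, ∃ V : Set (Euc n), IsOpen V ∧ x ∈ V ∧
    ∃ W : Set (Euc k), IsOpen W ∧ ∃ f : Euc k → Euc n, IsDiffeoOn f W (S ∩ V)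

/-- The vectors tangent to `S` at `ξ`: the velocities at time `0` of smooth curves in `S`
that pass through `ξ` at time `0`. -/
def tangentVectors {n : ℕ} (S : Set (Euc n)) (ξ : Euc n) : Set (Euc n) :=
  {v | ∃ (τ : ℝ) (γ : ℝ → Euc n), 0 < τ ∧ ContDiffOn ℝ ∞ γ (Set.Ioo (-τ) τ) ∧
    (∀ t ∈ Set.Ioo (-τ) τ, γ t ∈ S) ∧ γ 0 = ξ ∧ HasDerivAt γ v 0}

/-- The normal space `N_ξ(S)`, the orthogonal complement of the tangent space. -/
noncomputable def normalSpace {n : ℕ} (S : Set (Euc n)) (ξ : Euc n) : Submodule ℝ (Euc n) :=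
  (Submodule.span ℝ (tangentVectors S ξ))ᗮ

/-- The `ε`-neighbourhood `S^ε = {x : ‖x - ξ‖ < ε ξ for some ξ ∈ S}`. -/
def epsNbhd {n : ℕ} (S : Set (Euc n)) (ε : Euc n → ℝ) : Set (Euc n) :=
  {x | ∃ ξ ∈ S, ‖x - ξ‖ < ε ξ}

/-- `S^ε` is a tubular neighbourhood of `S` with nearest point retraction `π`: `ε` is continuous
and positive on `S`, every `x ∈ S^ε` has `π x` as its unique closest point in `S`, and
`π : S^ε → S` is a smooth submersion. -/
structure IsTubularNbhd {n : ℕ} (S : Set (Euc n)) (ε : Euc n → ℝ) (π : Euc n → Euc n) :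
    Prop where
  continuousOn : ContinuousOn ε S
  pos : ∀ ξ ∈ S, 0 < ε ξ
  mem : ∀ x ∈ epsNbhd S ε, π x ∈ S
  dist_eq : ∀ x ∈ epsNbhd S ε, ‖x - π x‖ = Metric.infDist x S
  unique : ∀ x ∈ epsNbhd S ε, ∀ ξ ∈ S, ‖x - ξ‖ = Metric.infDist x S → ξ = π x
  smooth : ContDiffOn ℝ ∞ π (epsNbhd S ε)
  submersion : ∀ x ∈ epsNbhd S ε, tangentVectors S (π x) ⊆ Set.range (fderiv ℝ π x)

/-- The map `(ξ, ω, ρ) ↦ ξ + ρ ∑ⱼ ωⱼ 𝐧ⱼ(ξ)` determined by vector fields `𝐧₁, …, 𝐧_d`. -/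
noncomputable def tubeMap {n d : ℕ} (frame : Fin d → Euc n → Euc n) :
    Euc n × Euc d × ℝ → Euc n :=
  fun p => p.1 + p.2.2 • ∑ j, p.2.1 j • frame j p.1

/-- A family `(U ν)` of bounded open subsets of `S^ε` whose traces cover `S`, each equipped with
a smooth orthonormal frame `frame ν 1, …, frame ν d` of the normal spaces along `S ∩ U ν` and a
radius `r ν > 0` such that the tube map of the frame is a diffeomorphism
`(S ∩ U ν) × 𝕊^{d-1} × (0, r ν) → U ν \ S`. -/
structure IsTubularCover {n d : ℕ} (S : Set (Euc n)) (ε : Euc n → ℝ) (U : ℕ → Set (Euc n))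
    (frame : ℕ → Fin d → Euc n → Euc n) (r : ℕ → ℝ) : Prop where
  isOpen : ∀ ν, IsOpen (U ν)
  bounded : ∀ ν, Bornology.IsBounded (U ν)
  subset : ∀ ν, U ν ⊆ epsNbhd S ε
  cover : S ⊆ ⋃ ν, U ν
  nonempty : ∀ ν, (U ν ∩ S).Nonempty
  frame_smooth : ∀ ν j, SmoothOnSet (frame ν j) (S ∩ U ν)
  frame_orthonormal : ∀ ν, ∀ ξ ∈ S ∩ U ν, Orthonormal ℝ (fun j => frame ν j ξ)
  frame_span : ∀ ν, ∀ ξ ∈ S ∩ U ν,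
    Submodule.span ℝ (Set.range fun j => frame ν j ξ) = normalSpace S ξ
  radius_pos : ∀ ν, 0 < r ν
  diffeo : ∀ ν, IsDiffeoOn (tubeMap (frame ν))
    ((S ∩ U ν) ×ˢ (Metric.sphere (0 : Euc d) 1 ×ˢ Set.Ioo 0 (r ν))) (U ν \ S)

section TubeCoordinates

/-- The tube coordinate `ρ_x = ‖x - π(x)‖`. -/
noncomputable def rhoCoord {n : ℕ} (π : Euc n → Euc n) (x : Euc n) : ℝ := ‖x - π x‖

/-- The tube coordinate `ω_x`, with components `ω_{x,k} = 𝐧ₖ(π(x)) · (x - π(x)) / ‖x - π(x)‖`.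
(The remaining tube coordinate is `ξ_x = π(x)`.) -/
noncomputable def omegaCoord {n d : ℕ} (π : Euc n → Euc n) (frame : Fin d → Euc n → Euc n)
    (x : Euc n) : Euc d :=
  WithLp.toLp 2 fun k => inner ℝ (frame k (π x)) (x - π x) / ‖x - π x‖

end TubeCoordinates

section Derivatives

variable {𝕜 : Type*} [RCLike 𝕜] {n : ℕ}

/-- The partial derivative `∂f/∂xᵢ`. -/
noncomputable def partialDeriv (i : Fin n) (f : Euc n → 𝕜) : Euc n → 𝕜 :=
  fun x => fderiv ℝ f x (EuclideanSpace.single i 1)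

/-- The operator `(∂/∂x)^α = (∂/∂x₁)^{α₁} ⋯ (∂/∂xₙ)^{αₙ}`. -/
noncomputable def multiDeriv (α : Fin n → ℕ) (f : Euc n → 𝕜) : Euc n → 𝕜 :=
  (List.finRange n).foldr (fun i g => (partialDeriv i)^[α i] g) f

/-- The order `|α|` of a multi-index. -/
def order (α : Fin n → ℕ) : ℤ := ∑ i, (α i : ℤ)

/-- The function `x ↦ a(ξ_x, ω_x) ρ_x ^ j`. -/
noncomputable def tubeTerm {d : ℕ} (π : Euc n → Euc n) (frame : Fin d → Euc n → Euc n)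
    (a : Euc n × Euc d → 𝕜) (j : ℤ) : Euc n → 𝕜 :=
  fun x => (rhoCoord π x ^ j) • a (π x, omegaCoord π frame x)

/-- `φ` has on the set `X` the uniform strong asymptotic expansion
`φ(x) ∼ ∑_{j ≥ m} a_j(ξ_x, ω_x) ρ_x ^ j` as `ρ_x → 0`: for every multi-index `α`,
`∂^α φ ∼ ∑_{j ≥ m} ∂^α (a_j(ξ_x, ω_x) ρ_x ^ j)`, i.e. for every `N ≥ m` the difference between
`∂^α φ` and the sum of the terms with `m ≤ j < N` is `O(ρ_x ^ (N - |α|))` as `ρ_x → 0`,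
uniformly for `x ∈ X`. -/
def HasStrongExpansion {d : ℕ} (X : Set (Euc n)) (π : Euc n → Euc n)
    (frame : Fin d → Euc n → Euc n) (φ : Euc n → 𝕜) (m : ℤ) (a : ℤ → Euc n × Euc d → 𝕜) :
    Prop :=
  ∀ α : Fin n → ℕ, ∀ N : ℤ, m ≤ N → ∃ C δ : ℝ, 0 < δ ∧ ∀ x ∈ X, rhoCoord π x < δ →
    ‖multiDeriv α φ x - ∑ j ∈ Finset.Ico m N, multiDeriv α (tubeTerm π frame (a j) j) x‖
      ≤ C * rhoCoord π x ^ (N - order α)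

/-- The space `𝒟^{[m;K]}_{*,S}(Ω)`: smooth functions on `Ω \ S` that vanish outside `K` and that
have, on each nonempty `Ω ∩ U ν \ S`, a uniform strong asymptotic expansion
`∑_{j ≥ m} a_j(ξ_x, ω_x) ρ_x ^ j` with `a_j ∈ C^∞((S ∩ U ν) × 𝕊^{d-1})`.
Only the values of `φ` on `Ω \ S` matter. -/
def testSpace (𝕜 : Type*) [RCLike 𝕜] {d : ℕ} (S Ω : Set (Euc n)) (π : Euc n → Euc n)
    (U : ℕ → Set (Euc n)) (frame : ℕ → Fin d → Euc n → Euc n) (m : ℤ) (K : Set (Euc n)) :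
    Set (Euc n → 𝕜) :=
  {φ | ContDiffOn ℝ ∞ φ (Ω \ S) ∧ (∀ x ∈ Ω \ S, x ∉ K → φ x = 0) ∧
    ∀ ν, ((Ω ∩ U ν) \ S).Nonempty → ∃ a : ℤ → Euc n × Euc d → 𝕜,
      (∀ j, SmoothOnSet (a j) ((S ∩ U ν) ×ˢ Metric.sphere (0 : Euc d) 1)) ∧
      HasStrongExpansion ((Ω ∩ U ν) \ S) π (frame ν) φ m a}

end Derivatives

end Thick

/-! A strong expansion says that the remainders satisfy symbol estimates in `ρ`
(`hasStrongExpansion_iff`), and these lose exactly one order per derivative. The difficulty is the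
individual term: where `S` is curved, `Dπ` varies along the normal fibres, so a derivative of `a(ξ,
ω) ρ ^ j` is no longer a single term and must be re-expanded in powers of `ρ`.

The terms are the smooth functions homogeneous of degree `j` under the dilations `τ_t x = π x + t (x
- π x)` (`isFiberHomogeneous_tubeTerm`, `IsFiberHomogeneous.exists_tubeTerm`). Let `P₀ = Dπ(π x)`,
the orthogonal projection onto the tangent space; let `B` be the inverse of `Dπ(x)` on the tangent
space and the identity on the normal space; let `A = 1 - B`. Differentiating `π ∘ τ_t = π` yields
`A(τ_t x) = t A(x)` (`shapeOp_fiberScale`, `shapeOp_mul_proj`). Iterating `Dπ = P₀ + A Dπ` inside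
`Dh v = Dh (v - P₀ v) + Dh (B Dπ v)` splits the derivative of a homogeneous `h` into terms of
degrees `j - 1, j, j + 1, …` plus a remainder (`fderiv_eq_sum_derivTerm`, `derivTerm_fiberScale`).
Collecting equal degrees gives the new coefficients.

The estimates must be uniform, although smoothness on `S ∩ U ν` alone does not bound the
coefficients. Their bounds come from the expansion itself, as differences of consecutive remainders.
A cutoff `χ ∘ π` confines `ξ` to a compact subset of `Ω`, and a crude symbol order improves to the
degree of homogeneity by dilating to a fixed radius (`IsFiberHomogeneous.isSymbol`). This settles
one partial derivative (`partialDeriv_mem_testSpace`); iteration does the rest. -/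

namespace Thick

/-! ### Calculus of iterated partial derivatives on open sets. -/

section PartialDerivatives

variable {𝕜 : Type*} [RCLike 𝕜] {n : ℕ} {V : Set (Euc n)} {f g : Euc n → 𝕜}

lemma _root_.ContDiffOn.partialDeriv (hf : ContDiffOn ℝ ∞ f V) (hV : IsOpen V) (i : Fin n) :
    ContDiffOn ℝ ∞ (partialDeriv i f) V :=
  (hf.fderiv_of_isOpen hV (by simp)).clm_apply contDiffOn_const

lemma _root_.Set.EqOn.partialDeriv (h : Set.EqOn f g V) (hV : IsOpen V) (i : Fin n) :
    Set.EqOn (partialDeriv i f) (partialDeriv i g) V := fun x hx => by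
  have : f =ᶠ[𝓝 x] g := h.eventuallyEq_of_mem (hV.mem_nhds hx)
  simp [Thick.partialDeriv, this.fderiv_eq]

lemma partialDeriv_comm (hV : IsOpen V) (hf : ContDiffOn ℝ ∞ f V) (i j : Fin n) :
    Set.EqOn (partialDeriv i (partialDeriv j f)) (partialDeriv j (partialDeriv i f)) V := by
  intro x hx
  have hfx : ContDiffAt ℝ ∞ f x := hf.contDiffAt (hV.mem_nhds hx)
  have hd : DifferentiableAt ℝ (fderiv ℝ f) x :=
    (hfx.fderiv_right (m := 1) (by norm_cast)).differentiableAt (by simp)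
  have hs : IsSymmSndFDerivAt ℝ f x := hfx.isSymmSndFDerivAt (by simp; norm_cast)
  have key : ∀ i j : Fin n, partialDeriv i (partialDeriv j f) x =
      fderiv ℝ (fderiv ℝ f) x (EuclideanSpace.single i 1) (EuclideanSpace.single j 1) := by
    intro i j
    unfold partialDeriv
    rw [fderiv_clm_apply hd (by fun_prop)]
    simp
  rw [key, key]
  exact hs _ _

lemma _root_.ContDiffOn.iterate_partialDeriv (hf : ContDiffOn ℝ ∞ f V) (hV : IsOpen V)
    (i : Fin n) (k : ℕ) : ContDiffOn ℝ ∞ ((Thick.partialDeriv i)^[k] f) V := by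
  induction k generalizing f with
  | zero => exact hf
  | succ k ih => exact ih (hf.partialDeriv hV i)

lemma _root_.Set.EqOn.iterate_partialDeriv (h : Set.EqOn f g V) (hV : IsOpen V)
    (i : Fin n) (k : ℕ) :
    Set.EqOn ((Thick.partialDeriv i)^[k] f) ((Thick.partialDeriv i)^[k] g) V := by
  induction k generalizing f g with
  | zero => exact h
  | succ k ih => exact ih (h.partialDeriv hV i)

lemma partialDeriv_iterate_comm (hV : IsOpen V) (hf : ContDiffOn ℝ ∞ f V) (i j : Fin n) (k : ℕ) :
    Set.EqOn (partialDeriv i ((partialDeriv j)^[k] f))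
      ((partialDeriv j)^[k] (partialDeriv i f)) V := by
  induction k generalizing f with
  | zero => exact fun _ _ => rfl
  | succ k ih =>
    exact (ih (hf.partialDeriv hV j)).trans
      ((partialDeriv_comm hV hf i j).iterate_partialDeriv hV j k)

/-- The operator obtained by applying `(∂/∂xᵢ)^{αᵢ}` for `i` in the list `l`. -/
noncomputable def listDeriv (l : List (Fin n)) (α : Fin n → ℕ) (f : Euc n → 𝕜) : Euc n → 𝕜 :=
  l.foldr (fun i g => (partialDeriv i)^[α i] g) f

lemma listDeriv_cons (i : Fin n) (l : List (Fin n)) (α : Fin n → ℕ) (f : Euc n → 𝕜) :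
    listDeriv (i :: l) α f = (partialDeriv i)^[α i] (listDeriv l α f) := rfl

lemma contDiffOn_listDeriv (hV : IsOpen V) (hf : ContDiffOn ℝ ∞ f V) (l : List (Fin n))
    (α : Fin n → ℕ) : ContDiffOn ℝ ∞ (listDeriv l α f) V := by
  induction l with
  | nil => exact hf
  | cons j l ih => exact ih.iterate_partialDeriv hV j _

lemma listDeriv_partialDeriv (hV : IsOpen V) (hf : ContDiffOn ℝ ∞ f V) (l : List (Fin n))
    (α : Fin n → ℕ) (i : Fin n) :
    Set.EqOn (listDeriv l α (partialDeriv i f)) (partialDeriv i (listDeriv l α f)) V := by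
  induction l with
  | nil => exact fun _ _ => rfl
  | cons j l ih =>
    exact (ih.iterate_partialDeriv hV j _).trans
      (partialDeriv_iterate_comm hV (contDiffOn_listDeriv hV hf l α) i j _).symm

lemma listDeriv_congr {l : List (Fin n)} {α β : Fin n → ℕ} (h : ∀ i ∈ l, α i = β i)
    (f : Euc n → 𝕜) : listDeriv l α f = listDeriv l β f := by
  induction l with
  | nil => rfl
  | cons j l ih =>
    rw [listDeriv_cons, listDeriv_cons, ih fun i hi => h i (List.mem_cons_of_mem _ hi),
      h j List.mem_cons_self]

lemma partialDeriv_listDeriv (hV : IsOpen V) (hf : ContDiffOn ℝ ∞ f V) {l : List (Fin n)}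
    (hl : l.Nodup) (α : Fin n → ℕ) {i : Fin n} (hi : i ∈ l) :
    Set.EqOn (partialDeriv i (listDeriv l α f)) (listDeriv l (α + Pi.single i 1) f) V := by
  induction l with
  | nil => simp at hi
  | cons j l ih =>
    rw [List.nodup_cons] at hl
    by_cases hij : j = i
    · subst hij
      have h1 : listDeriv l (α + Pi.single j 1) f = listDeriv l α f :=
        listDeriv_congr (fun k hk => by
          have : k ≠ j := fun h => hl.1 (h ▸ hk)
          simp [this]) f
      rw [listDeriv_cons, listDeriv_cons, h1]
      intro x _
      simp [Function.iterate_succ_apply']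
    · have hi' : i ∈ l := by
        rcases List.mem_cons.1 hi with h | h
        · exact absurd h.symm hij
        · exact h
      have h1 : (α + Pi.single i 1 : Fin n → ℕ) j = α j := by simp [hij]
      rw [listDeriv_cons, listDeriv_cons, h1]
      exact (partialDeriv_iterate_comm hV (contDiffOn_listDeriv hV hf l α) i j _).trans
        ((ih hl.2 hi').iterate_partialDeriv hV j _)

lemma multiDeriv_eq_listDeriv (α : Fin n → ℕ) (f : Euc n → 𝕜) :
    multiDeriv α f = listDeriv (List.finRange n) α f := rfl

lemma multiDeriv_partialDeriv (hV : IsOpen V) (hf : ContDiffOn ℝ ∞ f V) (α : Fin n → ℕ)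
    (i : Fin n) :
    Set.EqOn (multiDeriv α (partialDeriv i f)) (multiDeriv (α + Pi.single i 1) f) V :=
  (listDeriv_partialDeriv hV hf _ α i).trans
    (partialDeriv_listDeriv hV hf (List.nodup_finRange n) α (List.mem_finRange i))

lemma multiDeriv_zero (f : Euc n → 𝕜) : multiDeriv 0 f = f := by
  rw [multiDeriv_eq_listDeriv]
  induction List.finRange n with
  | nil => rfl
  | cons j l ih => rw [listDeriv_cons, ih]; rfl

lemma order_add_single (α : Fin n → ℕ) (i : Fin n) : order (α + Pi.single i 1) = order α + 1 := by
  simp [order, Finset.sum_add_distrib, Pi.single_apply]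

lemma partialDeriv_sub (hV : IsOpen V) (hf : ContDiffOn ℝ ∞ f V) (hg : ContDiffOn ℝ ∞ g V)
    (i : Fin n) : Set.EqOn (partialDeriv i (f - g)) (partialDeriv i f - partialDeriv i g) V := by
  intro x hx
  have h1 := (hf.contDiffAt (hV.mem_nhds hx)).differentiableAt (by simp)
  have h2 := (hg.contDiffAt (hV.mem_nhds hx)).differentiableAt (by simp)
  simp [partialDeriv, fderiv_sub h1 h2]

lemma iterate_partialDeriv_sub (hV : IsOpen V) (hf : ContDiffOn ℝ ∞ f V)
    (hg : ContDiffOn ℝ ∞ g V) (i : Fin n) (k : ℕ) :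
    Set.EqOn ((partialDeriv i)^[k] (f - g))
      ((partialDeriv i)^[k] f - (partialDeriv i)^[k] g) V := by
  induction k generalizing f g with
  | zero => exact fun _ _ => rfl
  | succ k ih =>
    exact ((partialDeriv_sub hV hf hg i).iterate_partialDeriv hV i k).trans
      (ih (hf.partialDeriv hV i) (hg.partialDeriv hV i))

lemma multiDeriv_sub (hV : IsOpen V) (hf : ContDiffOn ℝ ∞ f V)
    (hg : ContDiffOn ℝ ∞ g V) (α : Fin n → ℕ) :
    Set.EqOn (multiDeriv α (f - g)) (multiDeriv α f - multiDeriv α g) V := by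
  simp only [multiDeriv_eq_listDeriv]
  induction List.finRange n with
  | nil => exact fun _ _ => rfl
  | cons j l ih =>
    exact (ih.iterate_partialDeriv hV j _).trans (iterate_partialDeriv_sub hV
      (contDiffOn_listDeriv hV hf l α) (contDiffOn_listDeriv hV hg l α) j _)

lemma multiDeriv_sub_sum {ι : Type*} (hV : IsOpen V) (hf : ContDiffOn ℝ ∞ f V)
    (s : Finset ι) (h : ι → Euc n → 𝕜) (hh : ∀ j ∈ s, ContDiffOn ℝ ∞ (h j) V)
    (α : Fin n → ℕ) :
    Set.EqOn (multiDeriv α (fun x => f x - ∑ j ∈ s, h j x))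
      (fun x => multiDeriv α f x - ∑ j ∈ s, multiDeriv α (h j) x) V := by
  classical
  induction s using Finset.induction_on with
  | empty => simp [Set.EqOn]
  | insert a s ha ih =>
    have ih := ih fun j hj => hh j (Finset.mem_insert_of_mem hj)
    have e : (fun x => f x - ∑ j ∈ insert a s, h j x) = (fun x => f x - ∑ j ∈ s, h j x) - h a := by
      funext x
      simp only [Finset.sum_insert ha, Pi.sub_apply]
      ring
    have hs : ContDiffOn ℝ ∞ (fun x => f x - ∑ j ∈ s, h j x) V :=
      hf.sub (ContDiffOn.sum fun j hj => hh j (Finset.mem_insert_of_mem hj))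
    rw [e]
    intro x hx
    rw [multiDeriv_sub hV hs (hh a (Finset.mem_insert_self a s)) α hx, Pi.sub_apply, ih hx]
    simp only [Finset.sum_insert ha]
    ring

end PartialDerivatives

/-! ### Symbol estimates along a filter. -/

section Symbols

variable {n : ℕ} {E G H : Type*} [NormedAddCommGroup E] [NormedSpace ℝ E]
  [NormedAddCommGroup G] [NormedSpace ℝ G] [NormedAddCommGroup H] [NormedSpace ℝ H]
  {F : Filter (Euc n)} {ρ : Euc n → ℝ} {s t : ℤ} {f g : Euc n → E} {V : Set (Euc n)}

/-- `f` is a symbol of order `s` with respect to `ρ` along `F`: its derivatives of order `p` are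
`O(ρ ^ (s - p))`. -/
def IsSymbol (F : Filter (Euc n)) (ρ : Euc n → ℝ) (s : ℤ) (f : Euc n → E) : Prop :=
  ∀ p : ℕ, (fun x => iteratedFDeriv ℝ p f x) =O[F] fun x => ρ x ^ (s - p)

lemma IsSymbol.isBigO (hf : IsSymbol F ρ s f) : f =O[F] fun x => ρ x ^ s := by
  have h := (hf 0).norm_left
  simp only [norm_iteratedFDeriv_zero, Nat.cast_zero, sub_zero] at h
  exact h.of_norm_left

lemma IsSymbol.mono_filter {F' : Filter (Euc n)} (hf : IsSymbol F ρ s f) (h : F' ≤ F) :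
    IsSymbol F' ρ s f := fun p => (hf p).mono h

lemma IsSymbol.congr_eventually (hf : IsSymbol F ρ s f) (h : ∀ᶠ x in F, f =ᶠ[𝓝 x] g) :
    IsSymbol F ρ s g := fun p => by
  refine (hf p).congr' ?_ Filter.EventuallyEq.rfl
  filter_upwards [h] with x hx using (hx.iteratedFDeriv ℝ p).eq_of_nhds

lemma IsSymbol.congr (hV : IsOpen V) (hVF : V ∈ F) (hf : IsSymbol F ρ s f)
    (h : Set.EqOn f g V) : IsSymbol F ρ s g :=
  hf.congr_eventually (by
    filter_upwards [hVF] with x hx using h.eventuallyEq_of_mem (hV.mem_nhds hx))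

lemma IsSymbol.mono (hρ : ∀ᶠ x in F, 0 < ρ x ∧ ρ x < 1) (hf : IsSymbol F ρ s f) (h : t ≤ s) :
    IsSymbol F ρ t f := fun p => by
  refine (hf p).trans (Asymptotics.IsBigO.of_bound 1 ?_)
  filter_upwards [hρ] with x hx
  rw [one_mul, Real.norm_of_nonneg (zpow_nonneg hx.1.le _),
    Real.norm_of_nonneg (zpow_nonneg hx.1.le _)]
  exact zpow_le_zpow_right_of_le_one₀ hx.1 hx.2.le (by lia)

lemma IsSymbol.fderiv (hf : IsSymbol F ρ s f) : IsSymbol F ρ (s - 1) (_root_.fderiv ℝ f) := by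
  intro p
  have h := (hf (p + 1)).norm_left
  simp only [← norm_iteratedFDeriv_fderiv] at h
  refine h.of_norm_left.trans (Asymptotics.isBigO_of_le _ fun x => ?_)
  rw [show s - ((p + 1 : ℕ) : ℤ) = s - 1 - p by push_cast; ring]

lemma IsSymbol.add (hV : IsOpen V) (hVF : V ∈ F) (hfV : ContDiffOn ℝ ∞ f V)
    (hgV : ContDiffOn ℝ ∞ g V) (hf : IsSymbol F ρ s f) (hg : IsSymbol F ρ s g) :
    IsSymbol F ρ s (fun x => f x + g x) := fun p => by
  refine ((hf p).add (hg p)).congr' ?_ Filter.EventuallyEq.rfl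
  filter_upwards [hVF] with x hx
  exact (iteratedFDeriv_add_apply
    ((hfV.contDiffAt (hV.mem_nhds hx)).of_le (by exact_mod_cast le_top))
    ((hgV.contDiffAt (hV.mem_nhds hx)).of_le (by exact_mod_cast le_top))).symm

lemma IsSymbol.neg (hf : IsSymbol F ρ s f) : IsSymbol F ρ s (fun x => -f x) := fun p => by
  have : (fun x => iteratedFDeriv ℝ p (fun x => -f x) x) = fun x => -iteratedFDeriv ℝ p f x := by
    funext x
    exact iteratedFDeriv_neg_apply
  rw [this]
  exact (hf p).neg_left

lemma IsSymbol.sub (hV : IsOpen V) (hVF : V ∈ F) (hfV : ContDiffOn ℝ ∞ f V)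
    (hgV : ContDiffOn ℝ ∞ g V) (hf : IsSymbol F ρ s f) (hg : IsSymbol F ρ s g) :
    IsSymbol F ρ s (fun x => f x - g x) := by
  simpa only [sub_eq_add_neg] using hf.add hV hVF hfV hgV.neg hg.neg

lemma isSymbol_zero : IsSymbol F ρ s (fun _ => (0 : E)) := fun p => by
  have : (fun x : Euc n => iteratedFDeriv ℝ p (fun _ => (0 : E)) x) = fun _ => 0 := by
    funext x
    exact congrFun (iteratedFDeriv_fun_zero (𝕜 := ℝ) (E := Euc n) (F := E) (n := p)) x
  rw [this]
  exact Asymptotics.isBigO_zero _ _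

lemma IsSymbol.sum {ι : Type*} (hV : IsOpen V) (hVF : V ∈ F) (I : Finset ι)
    {f : ι → Euc n → E} (hfV : ∀ i ∈ I, ContDiffOn ℝ ∞ (f i) V)
    (hf : ∀ i ∈ I, IsSymbol F ρ s (f i)) : IsSymbol F ρ s (fun x => ∑ i ∈ I, f i x) := by
  classical
  induction I using Finset.induction_on with
  | empty => simpa using isSymbol_zero
  | insert a I ha ih =>
    simp only [Finset.sum_insert ha]
    exact (hf a (Finset.mem_insert_self a I)).add hV hVF (hfV a (Finset.mem_insert_self a I))
      (ContDiffOn.sum fun i hi => hfV i (Finset.mem_insert_of_mem hi))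
      (ih (fun i hi => hfV i (Finset.mem_insert_of_mem hi))
        fun i hi => hf i (Finset.mem_insert_of_mem hi))

/-- By the Leibniz rule each summand is `O(ρ ^ (s - i) * ρ ^ (t - (p - i)))`, so orders add.
Evaluation of operators and scalar multiplication are the instances used. -/
lemma IsSymbol.bilinear (B : E →L[ℝ] G →L[ℝ] H) (hρ : ∀ᶠ x in F, 0 < ρ x) (hV : IsOpen V)
    (hVF : V ∈ F) {f : Euc n → E} {g : Euc n → G} (hfV : ContDiffOn ℝ ∞ f V)
    (hgV : ContDiffOn ℝ ∞ g V) (hf : IsSymbol F ρ s f) (hg : IsSymbol F ρ t g) :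
    IsSymbol F ρ (s + t) (fun x => B (f x) (g x)) := fun p => by
  have h1 : (fun x => ∑ i ∈ Finset.range (p + 1), (p.choose i : ℝ) * ‖iteratedFDeriv ℝ i f x‖ *
      ‖iteratedFDeriv ℝ (p - i) g x‖) =O[F] fun x => ρ x ^ (s + t - p) := by
    refine Asymptotics.IsBigO.fun_sum fun i hi => ?_
    have hi' : i ≤ p := Nat.lt_succ_iff.1 (Finset.mem_range.1 hi)
    refine ((((hf i).norm_left.const_mul_left _).mul (hg (p - i)).norm_left).trans_eventuallyEq ?_)
    filter_upwards [hρ] with x hx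
    rw [← zpow_add₀ hx.ne']
    congr 1
    push_cast [Nat.cast_sub hi']
    ring
  refine (Asymptotics.IsBigO.of_bound ‖B‖ ?_).trans h1
  filter_upwards [hVF] with x hx
  have := B.norm_iteratedFDerivWithin_le_of_bilinear hfV hgV hV.uniqueDiffOn hx
    (n := p) (by exact_mod_cast le_top)
  simp only [iteratedFDerivWithin_of_isOpen _ hV hx] at this
  refine this.trans (mul_le_mul_of_nonneg_left (le_abs_self _) (by positivity))

lemma IsSymbol.clm_apply (hρ : ∀ᶠ x in F, 0 < ρ x) (hV : IsOpen V) (hVF : V ∈ F)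
    {f : Euc n → G →L[ℝ] H} {g : Euc n → G} (hfV : ContDiffOn ℝ ∞ f V)
    (hgV : ContDiffOn ℝ ∞ g V) (hf : IsSymbol F ρ s f) (hg : IsSymbol F ρ t g) :
    IsSymbol F ρ (s + t) (fun x => f x (g x)) :=
  IsSymbol.bilinear (ContinuousLinearMap.id ℝ (G →L[ℝ] H)) hρ hV hVF hfV hgV hf hg

lemma IsSymbol.smul (hρ : ∀ᶠ x in F, 0 < ρ x) (hV : IsOpen V) (hVF : V ∈ F)
    {f : Euc n → ℝ} {g : Euc n → G} (hfV : ContDiffOn ℝ ∞ f V)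
    (hgV : ContDiffOn ℝ ∞ g V) (hf : IsSymbol F ρ s f) (hg : IsSymbol F ρ t g) :
    IsSymbol F ρ (s + t) (fun x => f x • g x) :=
  IsSymbol.bilinear (ContinuousLinearMap.lsmul ℝ ℝ) hρ hV hVF hfV hgV hf hg

lemma IsSymbol.comp_left (L : E →L[ℝ] G) (hV : IsOpen V) (hVF : V ∈ F)
    (hfV : ContDiffOn ℝ ∞ f V) (hf : IsSymbol F ρ s f) : IsSymbol F ρ s (fun x => L (f x)) :=
  fun p => by
  refine (Asymptotics.IsBigO.of_bound ‖L‖ ?_).trans (hf p)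
  filter_upwards [hVF] with x hx
  exact L.norm_iteratedFDeriv_comp_left (hfV.contDiffAt (hV.mem_nhds hx))
    (by exact_mod_cast le_top)

/-- Locality of the symbol condition: it suffices to check it where `f` is not locally zero. -/
lemma IsSymbol.of_inf_principal {W : Set (Euc n)} (hf : IsSymbol (F ⊓ Filter.principal W) ρ s f)
    (h : ∀ᶠ x in F, x ∉ W → f =ᶠ[𝓝 x] 0) : IsSymbol F ρ s f := fun p => by
  obtain ⟨C, hC⟩ := (hf p).bound
  refine Asymptotics.IsBigO.of_bound (max C 0) ?_
  rw [Filter.eventually_inf_principal] at hC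
  filter_upwards [hC, h] with x h1 h2
  by_cases hx : x ∈ W
  · exact (h1 hx).trans (mul_le_mul_of_nonneg_right (le_max_left _ _) (norm_nonneg _))
  · have := ((h2 hx).iteratedFDeriv ℝ p).eq_of_nhds
    rw [this]
    have h0 : iteratedFDeriv ℝ p (0 : Euc n → E) x = 0 := by
      exact congrFun (iteratedFDeriv_fun_zero (𝕜 := ℝ) (E := Euc n) (F := E) (n := p)) x
    rw [h0, norm_zero]
    positivity

end Symbols

/-! ### Symbol estimates in terms of partial derivatives. -/

section SymbolsPartial

variable {𝕜 : Type*} [RCLike 𝕜] {n : ℕ} {F : Filter (Euc n)} {ρ : Euc n → ℝ} {s : ℤ}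
  {f : Euc n → 𝕜} {V : Set (Euc n)}

lemma IsSymbol.partialDeriv (hV : IsOpen V) (hVF : V ∈ F) (hfV : ContDiffOn ℝ ∞ f V)
    (hf : IsSymbol F ρ s f) (i : Fin n) :
    IsSymbol F ρ (s - 1) (Thick.partialDeriv i f) :=
  hf.fderiv.comp_left (ContinuousLinearMap.apply ℝ 𝕜 (EuclideanSpace.single i 1)) hV hVF
    (hfV.fderiv_of_isOpen hV (by simp))

lemma IsSymbol.iterate_partialDeriv (hV : IsOpen V) (hVF : V ∈ F) (hfV : ContDiffOn ℝ ∞ f V)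
    (hf : IsSymbol F ρ s f) (i : Fin n) (k : ℕ) :
    IsSymbol F ρ (s - k) ((Thick.partialDeriv i)^[k] f) := by
  induction k generalizing f s with
  | zero => simpa using hf
  | succ k ih =>
    have := ih (hfV.partialDeriv hV i) (hf.partialDeriv hV hVF hfV i)
    rwa [show s - 1 - (k : ℤ) = s - ((k + 1 : ℕ) : ℤ) by push_cast; ring] at this

lemma IsSymbol.multiDeriv (hV : IsOpen V) (hVF : V ∈ F) (hfV : ContDiffOn ℝ ∞ f V)
    (hf : IsSymbol F ρ s f) (α : Fin n → ℕ) :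
    IsSymbol F ρ (s - order α) (Thick.multiDeriv α f) := by
  have key : ∀ l : List (Fin n),
      IsSymbol F ρ (s - (l.map fun i => (α i : ℤ)).sum) (listDeriv l α f) := by
    intro l
    induction l with
    | nil => simpa [listDeriv] using hf
    | cons j l ih =>
      have := ih.iterate_partialDeriv hV hVF (contDiffOn_listDeriv hV hfV l α) j (α j)
      rwa [show s - (l.map fun i => (α i : ℤ)).sum - (α j : ℤ) =
        s - ((j :: l).map fun i => (α i : ℤ)).sum by simp; ring] at this
  have := key (List.finRange n)
  rwa [← Fin.sum_univ_def] at this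

/-- Bounds for the partial derivatives of all orders give the symbol estimates. -/
lemma IsSymbol.of_multiDeriv (hV : IsOpen V) (hVF : V ∈ F) (hfV : ContDiffOn ℝ ∞ f V)
    (hf : ∀ α : Fin n → ℕ, Thick.multiDeriv α f =O[F] fun x => ρ x ^ (s - order α)) :
    IsSymbol F ρ s f := by
  intro p
  induction p generalizing f s with
  | zero =>
    have h := (hf 0).norm_left
    simp only [multiDeriv_zero, order, Pi.zero_apply, Nat.cast_zero, Finset.sum_const_zero] at h
    refine Asymptotics.IsBigO.of_norm_left ?_
    simpa only [norm_iteratedFDeriv_zero, Nat.cast_zero] using h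
  | succ p ih =>
    have hi : ∀ i, (fun x => iteratedFDeriv ℝ p (Thick.partialDeriv i f) x) =O[F]
        fun x => ρ x ^ (s - 1 - p) := fun i => by
      refine ih (hfV.partialDeriv hV i) fun α => ?_
      have h := hf (α + Pi.single i 1)
      rw [order_add_single, ← sub_sub, sub_right_comm] at h
      refine h.congr' ?_ Filter.EventuallyEq.rfl
      filter_upwards [hVF] with x hx using (multiDeriv_partialDeriv hV hfV α i hx).symm
    let L : Fin n → 𝕜 →L[ℝ] (Euc n →L[ℝ] 𝕜) := fun i =>
      ContinuousLinearMap.smulRightL ℝ (Euc n) 𝕜 (EuclideanSpace.proj i : Euc n →L[ℝ] ℝ)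
    -- `Df` is a constant-coefficient combination of the `∂ᵢf`, so order `p + 1` for `f` reduces to
    -- order `p` for its partial derivatives, with `s` replaced by `s - 1`.
    have hL : _root_.fderiv ℝ f = fun x => ∑ i, L i (Thick.partialDeriv i f x) := by
      funext x
      ext v
      conv_lhs => rw [← (EuclideanSpace.basisFun (Fin n) ℝ).sum_repr v]
      simp [L, Thick.partialDeriv]
    have hsum : (fun x => ∑ i, ‖L i‖ * ‖iteratedFDeriv ℝ p (Thick.partialDeriv i f) x‖) =O[F]
        fun x => ρ x ^ (s - 1 - p) :=
      Asymptotics.IsBigO.fun_sum fun i _ => ((hi i).norm_left.const_mul_left _)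
    have hcast : s - ((p + 1 : ℕ) : ℤ) = s - 1 - p := by push_cast; ring
    rw [hcast]
    refine (Asymptotics.IsBigO.of_bound 1 ?_).trans hsum
    filter_upwards [hVF] with x hx
    rw [← norm_iteratedFDeriv_fderiv, one_mul, hL, iteratedFDeriv_fun_sum_apply]
    · refine (norm_sum_le _ _).trans ((Finset.sum_le_sum fun i _ => ?_).trans (le_abs_self _))
      exact (L i).norm_iteratedFDeriv_comp_left
        ((hfV.partialDeriv hV i).contDiffAt (hV.mem_nhds hx)) (by exact_mod_cast le_top)
    · intro i _
      exact ((L i).contDiff.comp_contDiffOn (hfV.partialDeriv hV i)).contDiffAt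
        (hV.mem_nhds hx) |>.of_le (by exact_mod_cast le_top)

end SymbolsPartial

/-! ### Geometry of the nearest point retraction. -/

/-- Near `ξ` this is local Lipschitz continuity; away from `ξ` the left side is bounded by
compactness and `‖y - ξ‖` is bounded below. It feeds the Grönwall argument for
`proj_add_smul_normal`. -/
lemma _root_.ContDiffAt.exists_norm_sub_le_of_isCompact {E G : Type*} [NormedAddCommGroup E]
    [NormedSpace ℝ E] [NormedAddCommGroup G] [NormedSpace ℝ G] {g : E → G} {ξ : E} {Q : Set E}
    (hg : ContDiffAt ℝ 1 g ξ) (hQ : IsCompact Q) (hgQ : ContinuousOn g Q) :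
    ∃ L : ℝ, ∀ y ∈ Q, ‖g y - g ξ‖ ≤ L * ‖y - ξ‖ := by
  obtain ⟨K, T, hT, hK⟩ := hg.exists_lipschitzOnWith
  obtain ⟨r, hr, hball⟩ := Metric.mem_nhds_iff.1 hT
  obtain ⟨C, hC⟩ := hQ.exists_bound_of_continuousOn (hgQ.sub (continuousOn_const (c := g ξ)))
  refine ⟨max (K : ℝ) (C / r), fun y hy => ?_⟩
  by_cases h : y ∈ Metric.ball ξ r
  · refine (hK.norm_sub_le (hball h) (hball (Metric.mem_ball_self hr))).trans ?_
    gcongr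
    exact le_max_left _ _
  · rw [Metric.mem_ball, not_lt, dist_eq_norm] at h
    have hC0 : 0 ≤ C := (norm_nonneg _).trans (hC y hy)
    calc ‖g y - g ξ‖ ≤ C := hC y hy
      _ = C / r * r := by field_simp
      _ ≤ max (K : ℝ) (C / r) * ‖y - ξ‖ := by
        gcongr
        exact le_max_right _ _

section Retraction

variable {n : ℕ} {S : Set (Euc n)} {ε : Euc n → ℝ} {π : Euc n → Euc n} {x ξ v w : Euc n} {t : ℝ}

lemma isOpen_epsNbhd : IsOpen (epsNbhd S ε) := by
  have : epsNbhd S ε = ⋃ ξ ∈ S, Metric.ball ξ (ε ξ) := by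
    ext x
    simp [epsNbhd, dist_eq_norm]
  rw [this]
  exact isOpen_biUnion fun _ _ => Metric.isOpen_ball

namespace IsTubularNbhd

lemma mem_epsNbhd (hπ : IsTubularNbhd S ε π)
    (hξ : ξ ∈ S) : ξ ∈ epsNbhd S ε := ⟨ξ, hξ, by simpa using hπ.pos ξ hξ⟩

lemma proj_mem_epsNbhd (hπ : IsTubularNbhd S ε π)
    (hx : x ∈ epsNbhd S ε) : π x ∈ epsNbhd S ε := hπ.mem_epsNbhd (hπ.mem x hx)

lemma proj_eq_self (hπ : IsTubularNbhd S ε π) (hξ : ξ ∈ S) : π ξ = ξ :=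
  (hπ.unique ξ (hπ.mem_epsNbhd hξ) ξ hξ (by simp [Metric.infDist_zero_of_mem hξ])).symm

lemma contDiffAt (hπ : IsTubularNbhd S ε π) (hx : x ∈ epsNbhd S ε) : ContDiffAt ℝ ∞ π x :=
  hπ.smooth.contDiffAt (isOpen_epsNbhd.mem_nhds hx)

lemma differentiableAt (hπ : IsTubularNbhd S ε π)
    (hx : x ∈ epsNbhd S ε) : DifferentiableAt ℝ π x :=
  (hπ.contDiffAt hx).differentiableAt (by simp)

/-- The image under `π` of a line through `x` is a curve in `S`. -/
lemma fderiv_mem_tangentVectors (hπ : IsTubularNbhd S ε π) (hx : x ∈ epsNbhd S ε) (w : Euc n) :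
    fderiv ℝ π x w ∈ tangentVectors S (π x) := by
  have hc : ContDiff ℝ ∞ fun t : ℝ => x + t • w := by fun_prop
  have hmem : (fun t : ℝ => x + t • w) ⁻¹' epsNbhd S ε ∈ 𝓝 (0 : ℝ) :=
    hc.continuous.continuousAt.preimage_mem_nhds (by simpa using isOpen_epsNbhd.mem_nhds hx)
  obtain ⟨τ, hτ, hball⟩ := Metric.mem_nhds_iff.1 hmem
  rw [Real.ball_eq_Ioo, zero_sub, zero_add] at hball
  refine ⟨τ, fun t => π (x + t • w), hτ, hπ.smooth.comp hc.contDiffOn hball,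
    fun t ht => hπ.mem _ (hball ht), by simp, ?_⟩
  have h1 : HasDerivAt (fun t : ℝ => x + t • w) w 0 := by
    simpa using ((hasDerivAt_id (0 : ℝ)).smul_const w).const_add x
  have h2 : HasFDerivAt π (fderiv ℝ π x) (x + (0 : ℝ) • w) := by
    simpa using (hπ.differentiableAt hx).hasFDerivAt
  exact h2.comp_hasDerivAt 0 h1

lemma fderiv_apply_of_tangent (hπ : IsTubularNbhd S ε π) (hξ : ξ ∈ S)
    (hv : v ∈ tangentVectors S ξ) :
    fderiv ℝ π ξ v = v := by
  obtain ⟨τ, γ, hτ, -, hγS, h0, hd⟩ := hv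
  have h1 : HasDerivAt (fun t => π (γ t)) (fderiv ℝ π ξ v) 0 := by
    have h2 : HasFDerivAt π (fderiv ℝ π ξ) (γ 0) := by
      rw [h0]
      exact (hπ.differentiableAt (hπ.mem_epsNbhd hξ)).hasFDerivAt
    exact h2.comp_hasDerivAt 0 hd
  refine h1.unique (hd.congr_of_eventuallyEq ?_)
  filter_upwards [Ioo_mem_nhds (neg_lt_zero.2 hτ) hτ] with t ht
  exact hπ.proj_eq_self (hγS t ht)

/-- First variation: along a curve in `S` through `π x`, the squared distance to `x` is minimal at
time `0`. -/
lemma inner_sub_proj_tangent (hπ : IsTubularNbhd S ε π)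
    (hx : x ∈ epsNbhd S ε) (hv : v ∈ tangentVectors S (π x)) :
    inner ℝ (x - π x) v = 0 := by
  obtain ⟨τ, γ, hτ, -, hγS, h0, hd⟩ := hv
  have h1 : HasDerivAt (fun t => ‖x - γ t‖ ^ 2) (2 * inner ℝ (x - γ 0) (-v)) 0 := by
    simpa using (hd.const_sub x).norm_sq
  have hmin : IsLocalMin (fun t => ‖x - γ t‖ ^ 2) 0 := by
    filter_upwards [Ioo_mem_nhds (neg_lt_zero.2 hτ) hτ] with t ht
    have h2 := Metric.infDist_le_dist_of_mem (x := x) (hγS t ht)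
    rw [← hπ.dist_eq x hx, dist_eq_norm] at h2
    rw [h0]
    gcongr
  have := hmin.hasDerivAt_eq_zero h1
  rw [h0, inner_neg_right] at this
  linarith

/-- The squared distance `‖y - π y‖ ^ 2` has gradient `2 (y - π y)`, because the contribution of
`Dπ` is tangent and hence orthogonal to `y - π y`. Its Hessian `2 (1 - Dπ)` is symmetric. -/
lemma fderiv_symm (hπ : IsTubularNbhd S ε π) (hx : x ∈ epsNbhd S ε) (v w : Euc n) :
    inner ℝ (fderiv ℝ π x v) w = inner ℝ v (fderiv ℝ π x w) := by
  have hu : ∀ y ∈ epsNbhd S ε, HasFDerivAt (fun y => ‖y - π y‖ ^ 2)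
      (2 • innerSL ℝ (y - π y)) y := by
    intro y hy
    have h1 : HasFDerivAt (fun y => y - π y) (ContinuousLinearMap.id ℝ (Euc n) - fderiv ℝ π y) y :=
      (hasFDerivAt_id y).sub (hπ.differentiableAt hy).hasFDerivAt
    convert! h1.norm_sq using 1
    ext w
    have := hπ.inner_sub_proj_tangent hy (hπ.fderiv_mem_tangentVectors hy w)
    simp [inner_sub_left] at this ⊢
    linarith
  have hsm : ContDiffAt ℝ ∞ (fun y => ‖y - π y‖ ^ 2) x :=
    (contDiffAt_id.sub (hπ.contDiffAt hx)).norm_sq ℝ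
  have hsym : IsSymmSndFDerivAt ℝ (fun y => ‖y - π y‖ ^ 2) x :=
    hsm.isSymmSndFDerivAt (by simp; norm_cast)
  have hEq : fderiv ℝ (fun y => ‖y - π y‖ ^ 2) =ᶠ[𝓝 x] fun y => 2 • innerSL ℝ (y - π y) := by
    filter_upwards [isOpen_epsNbhd.mem_nhds hx] with y hy using (hu y hy).fderiv
  have hD : HasFDerivAt (fun y => 2 • innerSL ℝ (y - π y))
      (2 • (innerSL ℝ).comp (ContinuousLinearMap.id ℝ (Euc n) - fderiv ℝ π x)) x :=
    ((innerSL ℝ).hasFDerivAt.comp x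
      ((hasFDerivAt_id x).sub (hπ.differentiableAt hx).hasFDerivAt)).const_smul 2
  have h := hsym v w
  rw [hEq.fderiv_eq, hD.fderiv] at h
  simp only [smul_apply, ContinuousLinearMap.comp_apply, sub_apply,
    ContinuousLinearMap.id_apply, innerSL_apply_apply, map_sub, nsmul_eq_mul,
    Nat.cast_ofNat] at h
  have h1 := real_inner_comm v w
  have h2 := real_inner_comm (fderiv ℝ π x w) v
  linarith

lemma fderiv_proj_mul_fderiv (hπ : IsTubularNbhd S ε π) (hx : x ∈ epsNbhd S ε) :
    fderiv ℝ π (π x) * fderiv ℝ π x = fderiv ℝ π x := by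
  ext1 v
  exact hπ.fderiv_apply_of_tangent (hπ.mem x hx) (hπ.fderiv_mem_tangentVectors hx v)

/-- The adjoint of `fderiv_proj_mul_fderiv`, both factors being symmetric. -/
lemma fderiv_mul_fderiv_proj (hπ : IsTubularNbhd S ε π) (hx : x ∈ epsNbhd S ε) :
    fderiv ℝ π x * fderiv ℝ π (π x) = fderiv ℝ π x := by
  ext1 v
  refine ext_inner_right ℝ fun w => ?_
  rw [mul_apply_eq_comp, hπ.fderiv_symm hx, hπ.fderiv_symm (hπ.proj_mem_epsNbhd hx),
    hπ.fderiv_symm hx, ← mul_apply_eq_comp, hπ.fderiv_proj_mul_fderiv hx]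

lemma fderiv_proj_mul_self (hπ : IsTubularNbhd S ε π) (hx : x ∈ epsNbhd S ε) :
    fderiv ℝ π (π x) * fderiv ℝ π (π x) = fderiv ℝ π (π x) := by
  have := hπ.fderiv_proj_mul_fderiv (hπ.proj_mem_epsNbhd hx)
  rwa [hπ.proj_eq_self (hπ.mem x hx)] at this

lemma fderiv_normal (hπ : IsTubularNbhd S ε π)
    (hx : x ∈ epsNbhd S ε) (hv : v ∈ normalSpace S (π x)) :
    fderiv ℝ π x v = 0 := by
  refine ext_inner_right ℝ fun w => ?_
  rw [hπ.fderiv_symm hx, inner_zero_left, real_inner_comm]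
  exact hv _ (Submodule.subset_span (hπ.fderiv_mem_tangentVectors hx w))

/-- The retraction is constant on segments issuing from `S` in a normal direction, as long as they
stay in the tubular neighbourhood. -/
lemma proj_add_smul_normal (hπ : IsTubularNbhd S ε π) (hξ : ξ ∈ S)
    (hv : v ∈ normalSpace S ξ) {b : ℝ}
    (hseg : ∀ s ∈ Set.Icc 0 b, ξ + s • v ∈ epsNbhd S ε) :
    ∀ s ∈ Set.Icc 0 b, π (ξ + s • v) = ξ := by
  have hc : Continuous fun s : ℝ => ξ + s • v := by fun_prop
  have hq : ContinuousOn (fun s : ℝ => π (ξ + s • v)) (Set.Icc 0 b) :=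
    hπ.smooth.continuousOn.comp hc.continuousOn hseg
  have hP : ContinuousOn (fderiv ℝ π) (epsNbhd S ε) :=
    (hπ.smooth.fderiv_of_isOpen isOpen_epsNbhd (m := ∞) (by simp)).continuousOn
  obtain ⟨C, hC⟩ := isCompact_Icc.exists_bound_of_continuousOn (hP.comp hc.continuousOn hseg)
  have hξN := hπ.mem_epsNbhd hξ
  have hP1 : ContDiffAt ℝ 1 (fderiv ℝ π) ξ :=
    (hπ.contDiffAt hξN).fderiv_right (by norm_cast)
  obtain ⟨L, hL⟩ := hP1.exists_norm_sub_le_of_isCompact (isCompact_Icc.image_of_continuousOn hq)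
    (hP.mono (by
      rintro _ ⟨s, hs, rfl⟩
      exact hπ.proj_mem_epsNbhd (hseg s hs)))
  have hPv : fderiv ℝ π ξ v = 0 :=
    hπ.fderiv_normal hξN (by rwa [hπ.proj_eq_self hξ])
  -- Grönwall for the displacement `π (ξ + s • v) - ξ`, which vanishes at `s = 0`: its speed is at
  -- most a constant times its own size.
  have key := eq_zero_of_abs_deriv_le_mul_abs_self_of_eq_zero_right
    (f := fun s : ℝ => π (ξ + s • v) - ξ) (f' := fun s => fderiv ℝ π (ξ + s • v) v)
    (K := C * L * ‖v‖) (hq.sub continuousOn_const) ?_ (by simp [hπ.proj_eq_self hξ]) ?_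
  · intro s hs
    exact sub_eq_zero.1 (key s hs)
  · intro s hs
    have h1 : HasDerivAt (fun s : ℝ => ξ + s • v) v s := by
      simpa using ((hasDerivAt_id s).smul_const v).const_add ξ
    exact (((hπ.differentiableAt (hseg s (Set.Ico_subset_Icc_self hs))).hasFDerivAt.comp_hasDerivAt
      s h1).sub_const ξ).hasDerivWithinAt
  · intro s hs
    have hs' := Set.Ico_subset_Icc_self hs
    have hC0 : 0 ≤ C := (norm_nonneg _).trans (hC s hs')
    -- Inserting `Dπ(x) = Dπ(x) Dπ(π x)` and subtracting `Dπ(ξ) v = 0` exhibits the difference of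
    -- `Dπ` at `π (ξ + s • v)` and at `ξ`, which the displacement controls.
    have e : fderiv ℝ π (ξ + s • v) v = fderiv ℝ π (ξ + s • v)
        ((fderiv ℝ π (π (ξ + s • v)) - fderiv ℝ π ξ) v) := by
      conv_lhs => rw [← hπ.fderiv_mul_fderiv_proj (hseg s hs')]
      simp [hPv]
    rw [e]
    calc _ ≤ ‖fderiv ℝ π (ξ + s • v)‖ * ‖(fderiv ℝ π (π (ξ + s • v)) - fderiv ℝ π ξ) v‖ :=
          ContinuousLinearMap.le_opNorm _ _
      _ ≤ C * ((L * ‖π (ξ + s • v) - ξ‖) * ‖v‖) := by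
          gcongr
          · exact hC s hs'
          · refine (ContinuousLinearMap.le_opNorm _ _).trans ?_
            gcongr
            exact hL _ ⟨s, hs', rfl⟩
      _ = _ := by ring

end IsTubularNbhd

end Retraction

/-! ### The shape operator and its behaviour under fibre dilations. -/

section ShapeOperator

variable {n : ℕ} {S : Set (Euc n)} {ε : Euc n → ℝ} {π : Euc n → Euc n} {x v : Euc n} {t : ℝ}

lemma clm_mul_smul (A B : Euc n →L[ℝ] Euc n) (t : ℝ) : A * (t • B) = t • (A * B) := by
  ext1 v
  simp

lemma clm_smul_mul (A B : Euc n →L[ℝ] Euc n) (t : ℝ) : (t • A) * B = t • (A * B) := by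
  ext1 v
  simp

/-- The operator which inverts `Dπ(x)` on the tangent space at `π x` and is the identity on the
normal space. -/
noncomputable def retractInverse (π : Euc n → Euc n) (x : Euc n) : Euc n →L[ℝ] Euc n :=
  Ring.inverse (fderiv ℝ π x + (1 - fderiv ℝ π (π x)))

/-- The shape operator in the direction `x - π x`, extended by zero to the normal space. -/
noncomputable def shapeOp (π : Euc n → Euc n) (x : Euc n) : Euc n →L[ℝ] Euc n :=
  1 - retractInverse π x

/-- Dilation by the factor `t` in the fibres of `π`. -/
def fiberScale (π : Euc n → Euc n) (t : ℝ) (x : Euc n) : Euc n := π x + t • (x - π x)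

namespace IsTubularNbhd

/-- For `v` in the kernel, applying `P₀ = Dπ(π x)` gives `Dπ(x) v = 0`, so `v = P₀ v` is tangent.
Submersivity gives `v = Dπ(x) u`, whence `⟪v, v⟫ = ⟪u, Dπ(x) v⟫ = 0` by symmetry. -/
lemma isUnit_retract (hπ : IsTubularNbhd S ε π) (hx : x ∈ epsNbhd S ε) :
    IsUnit (fderiv ℝ π x + (1 - fderiv ℝ π (π x))) := by
  rw [ContinuousLinearMap.isUnit_iff_isUnit_toLinearMap, LinearMap.isUnit_iff_ker_eq_bot,
    LinearMap.ker_eq_bot']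
  intro v hv
  have hv0 : fderiv ℝ π x v + (v - fderiv ℝ π (π x) v) = 0 := by simpa using hv
  have hPv : fderiv ℝ π x v = 0 := by
    have h1 := congrArg (fderiv ℝ π (π x)) hv0
    rwa [map_add, map_sub, map_zero, ← mul_apply_eq_comp, ← mul_apply_eq_comp,
      hπ.fderiv_proj_mul_fderiv hx, hπ.fderiv_proj_mul_self hx, sub_self, add_zero] at h1
  rw [hPv, zero_add, sub_eq_zero] at hv0
  have htan : v ∈ tangentVectors S (π x) := by
    have h2 := hπ.fderiv_mem_tangentVectors (hπ.proj_mem_epsNbhd hx) v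
    rwa [← hv0, hπ.proj_eq_self (hπ.mem x hx)] at h2
  obtain ⟨u, hu⟩ := hπ.submersion x hx htan
  rw [← inner_self_eq_zero (𝕜 := ℝ)]
  nth_rewrite 1 [← hu]
  rw [hπ.fderiv_symm hx, hPv, inner_zero_right]

lemma retractInverse_mul (hπ : IsTubularNbhd S ε π) (hx : x ∈ epsNbhd S ε) :
    retractInverse π x * (fderiv ℝ π x + (1 - fderiv ℝ π (π x))) = 1 :=
  Ring.inverse_mul_cancel _ (hπ.isUnit_retract hx)

lemma mul_retractInverse (hπ : IsTubularNbhd S ε π) (hx : x ∈ epsNbhd S ε) :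
    (fderiv ℝ π x + (1 - fderiv ℝ π (π x))) * retractInverse π x = 1 :=
  Ring.mul_inverse_cancel _ (hπ.isUnit_retract hx)

lemma retractInverse_mul_fderiv (hπ : IsTubularNbhd S ε π) (hx : x ∈ epsNbhd S ε) :
    retractInverse π x * fderiv ℝ π x = fderiv ℝ π (π x) := by
  have h : (fderiv ℝ π x + (1 - fderiv ℝ π (π x))) * fderiv ℝ π (π x) = fderiv ℝ π x := by
    rw [add_mul, sub_mul, one_mul, hπ.fderiv_mul_fderiv_proj hx, hπ.fderiv_proj_mul_self hx,
      sub_self, add_zero]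
  calc retractInverse π x * fderiv ℝ π x
      = retractInverse π x * ((fderiv ℝ π x + (1 - fderiv ℝ π (π x))) * fderiv ℝ π (π x)) := by
        rw [h]
    _ = fderiv ℝ π (π x) := by rw [← mul_assoc, hπ.retractInverse_mul hx, one_mul]

lemma fderiv_mul_retractInverse (hπ : IsTubularNbhd S ε π) (hx : x ∈ epsNbhd S ε) :
    fderiv ℝ π x * retractInverse π x = fderiv ℝ π (π x) := by
  have h : fderiv ℝ π (π x) * (fderiv ℝ π x + (1 - fderiv ℝ π (π x))) = fderiv ℝ π x := by
    rw [mul_add, mul_sub, mul_one, hπ.fderiv_proj_mul_fderiv hx, hπ.fderiv_proj_mul_self hx,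
      sub_self, add_zero]
  calc fderiv ℝ π x * retractInverse π x
      = fderiv ℝ π (π x) * (fderiv ℝ π x + (1 - fderiv ℝ π (π x))) * retractInverse π x := by
        rw [h]
    _ = fderiv ℝ π (π x) := by rw [mul_assoc, hπ.mul_retractInverse hx, mul_one]

lemma commute_proj_retractInverse (hπ : IsTubularNbhd S ε π) (hx : x ∈ epsNbhd S ε) :
    Commute (fderiv ℝ π (π x)) (retractInverse π x) := by
  have h : fderiv ℝ π (π x) * retractInverse π x =
      retractInverse π x * (fderiv ℝ π x * retractInverse π x) := by
    rw [← mul_assoc, hπ.retractInverse_mul_fderiv hx]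
  rw [hπ.fderiv_mul_retractInverse hx] at h
  exact h

lemma commute_proj_shapeOp (hπ : IsTubularNbhd S ε π) (hx : x ∈ epsNbhd S ε) :
    Commute (fderiv ℝ π (π x)) (shapeOp π x) :=
  (Commute.one_right _).sub_right (hπ.commute_proj_retractInverse hx)

/-- The identity `B Dπ(x) = P₀` with `B = 1 - A`, in fixed-point form; iterating it produces a
finite Neumann expansion with exact remainder. -/
lemma fderiv_eq_add_shapeOp_mul (hπ : IsTubularNbhd S ε π) (hx : x ∈ epsNbhd S ε) :
    fderiv ℝ π x = fderiv ℝ π (π x) + shapeOp π x * fderiv ℝ π x := by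
  rw [shapeOp, sub_mul, one_mul, hπ.retractInverse_mul_fderiv hx]
  abel

lemma shapeOp_mul_proj (hπ : IsTubularNbhd S ε π) (hx : x ∈ epsNbhd S ε) :
    shapeOp π x * fderiv ℝ π (π x) = shapeOp π x := by
  have h : shapeOp π x * (1 - fderiv ℝ π (π x)) = 0 := by
    have h1 : (fderiv ℝ π x + (1 - fderiv ℝ π (π x))) * (1 - fderiv ℝ π (π x)) =
        1 - fderiv ℝ π (π x) := by
      rw [add_mul, mul_sub, mul_one, hπ.fderiv_mul_fderiv_proj hx, sub_self, zero_add, mul_sub,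
        mul_one, sub_mul, one_mul, hπ.fderiv_proj_mul_self hx, sub_self, sub_zero]
    have h2 : retractInverse π x * (1 - fderiv ℝ π (π x)) = 1 - fderiv ℝ π (π x) := by
      conv_lhs => rw [← h1]
      rw [← mul_assoc, hπ.retractInverse_mul hx, one_mul]
    rw [shapeOp, sub_mul, one_mul, h2, sub_self]
  rw [mul_sub, mul_one, sub_eq_zero] at h
  exact h.symm

lemma contDiffOn_fderiv (hπ : IsTubularNbhd S ε π) : ContDiffOn ℝ ∞ (fderiv ℝ π) (epsNbhd S ε) :=
  hπ.smooth.fderiv_of_isOpen isOpen_epsNbhd (by simp)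

lemma contDiffOn_fderiv_proj (hπ : IsTubularNbhd S ε π) :
    ContDiffOn ℝ ∞ (fun x => fderiv ℝ π (π x)) (epsNbhd S ε) :=
  hπ.contDiffOn_fderiv.comp hπ.smooth fun _ hx => hπ.proj_mem_epsNbhd hx

lemma contDiffOn_retractInverse (hπ : IsTubularNbhd S ε π) :
    ContDiffOn ℝ ∞ (retractInverse π) (epsNbhd S ε) := by
  intro x hx
  obtain ⟨u, hu⟩ := hπ.isUnit_retract hx
  have h1 : ContDiffAt ℝ ∞ Ring.inverse (fderiv ℝ π x + (1 - fderiv ℝ π (π x))) :=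
    hu ▸ contDiffAt_ringInverse ℝ u
  exact h1.comp_contDiffWithinAt x
    ((hπ.contDiffOn_fderiv x hx).add (contDiffWithinAt_const.sub (hπ.contDiffOn_fderiv_proj x hx)))

lemma contDiffOn_shapeOp (hπ : IsTubularNbhd S ε π) :
    ContDiffOn ℝ ∞ (shapeOp π) (epsNbhd S ε) :=
  contDiffOn_const.sub hπ.contDiffOn_retractInverse

lemma contDiffOn_fiberScale (hπ : IsTubularNbhd S ε π) (t : ℝ) :
    ContDiffOn ℝ ∞ (fiberScale π t) (epsNbhd S ε) :=
  hπ.smooth.add ((contDiffOn_id.sub hπ.smooth).const_smul t)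

lemma hasFDerivAt_fiberScale (hπ : IsTubularNbhd S ε π) (hx : x ∈ epsNbhd S ε) (t : ℝ) :
    HasFDerivAt (fiberScale π t) (fderiv ℝ π x + t • (1 - fderiv ℝ π x)) x :=
  have h := (hπ.differentiableAt hx).hasFDerivAt
  h.add (((hasFDerivAt_id x).sub h).const_smul t)

lemma fderiv_fiberScale_mul (hπ : IsTubularNbhd S ε π) (hx : x ∈ epsNbhd S ε)
    (ht : fiberScale π t x ∈ epsNbhd S ε) (hD : ∀ᶠ z in 𝓝 x, π (fiberScale π t z) = π z) :
    fderiv ℝ π (fiberScale π t x) * (fderiv ℝ π x + t • (1 - fderiv ℝ π x)) = fderiv ℝ π x := by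
  have h1 := (hπ.differentiableAt ht).hasFDerivAt.comp x (hπ.hasFDerivAt_fiberScale hx t)
  exact h1.unique ((hπ.differentiableAt hx).hasFDerivAt.congr_of_eventuallyEq hD)

/-- Since `Dπ(τ_t x) Dτ_t(x) = Dπ(x)` and `Dπ(x) B = P₀`, the operator inverted at `τ_t x` sends
`Dτ_t(x) B P₀` to `P₀`; the factor `1 - P₀` contributes nothing because `Dτ_t(x) B P₀` has
tangential range. -/
lemma retractInverse_fiberScale (hπ : IsTubularNbhd S ε π) (hx : x ∈ epsNbhd S ε)
    (ht : fiberScale π t x ∈ epsNbhd S ε) (hD : ∀ᶠ z in 𝓝 x, π (fiberScale π t z) = π z) :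
    retractInverse π (fiberScale π t x) * fderiv ℝ π (π x) =
      (fderiv ℝ π x + t • (1 - fderiv ℝ π x)) * retractInverse π x * fderiv ℝ π (π x) := by
  have hp : π (fiberScale π t x) = π x := hD.self_of_nhds
  have hB := hπ.retractInverse_mul ht
  rw [hp] at hB
  set P := fderiv ℝ π x
  set P' := fderiv ℝ π (fiberScale π t x)
  set P0 := fderiv ℝ π (π x)
  set B := retractInverse π x
  have e1 : P' * (P + t • (1 - P)) = P := hπ.fderiv_fiberScale_mul hx ht hD
  have e2 : P * B = P0 := hπ.fderiv_mul_retractInverse hx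
  have e3 : P0 * P0 = P0 := hπ.fderiv_proj_mul_self hx
  have e4 : P0 * B = B * P0 := hπ.commute_proj_retractInverse hx
  have e5 : P0 * P = P := hπ.fderiv_proj_mul_fderiv hx
  have h0 : (1 - P0) * P = 0 := by rw [sub_mul, one_mul, e5, sub_self]
  have h1 : (P' + (1 - P0)) * ((P + t • (1 - P)) * B * P0) = P0 := by
    have h2 : (1 - P0) * ((P + t • (1 - P)) * B * P0) = 0 := by
      have : (1 - P0) * (B * P0) = 0 := by
        rw [← e4, ← mul_assoc, sub_mul, one_mul, e3, sub_self, zero_mul]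
      rw [mul_assoc, ← mul_assoc, mul_add, h0, zero_add, clm_mul_smul, mul_sub, mul_one, h0,
        sub_zero, clm_smul_mul, this]
      ext1 u
      simp
    rw [add_mul, h2, add_zero, ← mul_assoc, ← mul_assoc, e1, e2, e3]
  conv_lhs => rw [← h1]
  rw [← mul_assoc, hB, one_mul]

/-- With `Dπ(x) B = P₀`, the preceding formula becomes `B(τ_t x) P₀ = P₀ + t (B P₀ - P₀)`, which is
affine in `t`. -/
lemma shapeOp_fiberScale (hπ : IsTubularNbhd S ε π) (hx : x ∈ epsNbhd S ε)
    (ht : fiberScale π t x ∈ epsNbhd S ε) (hD : ∀ᶠ z in 𝓝 x, π (fiberScale π t z) = π z) :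
    shapeOp π (fiberScale π t x) * fderiv ℝ π (π x) =
      t • (shapeOp π x * fderiv ℝ π (π x)) := by
  rw [shapeOp, sub_mul, hπ.retractInverse_fiberScale hx ht hD, add_mul,
    hπ.fderiv_mul_retractInverse hx, add_mul, hπ.fderiv_proj_mul_self hx, clm_smul_mul, sub_mul,
    hπ.fderiv_mul_retractInverse hx, clm_smul_mul, sub_mul, hπ.fderiv_proj_mul_self hx, shapeOp,
    sub_mul, one_mul, one_mul, smul_sub, smul_sub]
  abel

lemma shapeOp_pow_fiberScale (hπ : IsTubularNbhd S ε π) (hx : x ∈ epsNbhd S ε)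
    (ht : fiberScale π t x ∈ epsNbhd S ε) (hD : ∀ᶠ z in 𝓝 x, π (fiberScale π t z) = π z)
    (l : ℕ) :
    shapeOp π (fiberScale π t x) ^ l * fderiv ℝ π (π x) =
      t ^ l • (shapeOp π x ^ l * fderiv ℝ π (π x)) := by
  have hc : shapeOp π x * fderiv ℝ π (π x) = fderiv ℝ π (π x) * shapeOp π x :=
    (hπ.commute_proj_shapeOp hx).eq.symm
  induction l with
  | zero => simp
  | succ l ih =>
    rw [pow_succ, mul_assoc, hπ.shapeOp_fiberScale hx ht hD, clm_mul_smul, hc, ← mul_assoc, ih,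
      clm_smul_mul, smul_smul, mul_assoc, ← hc, ← mul_assoc, ← pow_succ, pow_succ' t]

end IsTubularNbhd

/-! ### Expansion of a directional derivative into homogeneous terms. -/

section DerivTerm

variable {E : Type*} [NormedAddCommGroup E] [NormedSpace ℝ E] {f : Euc n → E} {V : Set (Euc n)}

/-- The terms of the expansion of the derivative of `f` in the direction `v` near `S`. -/
noncomputable def derivTerm (π : Euc n → Euc n) (f : Euc n → E) (v : Euc n) : ℕ → Euc n → E
  | 0, x => fderiv ℝ f x (v - fderiv ℝ π (π x) v)
  | l + 1, x => fderiv ℝ f x (retractInverse π x ((shapeOp π x ^ l) (fderiv ℝ π (π x) v)))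

/-- The remainder of the expansion of the derivative of `f` in the direction `v` near `S`. -/
noncomputable def derivRemainder (π : Euc n → Euc n) (f : Euc n → E) (v : Euc n) (l : ℕ)
    (x : Euc n) : E :=
  fderiv ℝ f x (retractInverse π x ((shapeOp π x ^ l) (fderiv ℝ π x v)))

namespace IsTubularNbhd

/-- Split `v` as `(v - P₀ v) + B Dπ(x) v`, using `P₀ = B Dπ(x)`, then substitute `Dπ = P₀ + A Dπ`
repeatedly in the rightmost factor. -/
lemma fderiv_eq_sum_derivTerm (hπ : IsTubularNbhd S ε π) (hx : x ∈ epsNbhd S ε) (f : Euc n → E)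
    (v : Euc n) (l : ℕ) :
    fderiv ℝ f x v = ∑ i ∈ Finset.range (l + 1), derivTerm π f v i x +
      derivRemainder π f v l x := by
  induction l with
  | zero =>
    simp only [zero_add, Finset.range_one, Finset.sum_singleton, derivTerm, derivRemainder,
      pow_zero, one_apply_eq_self]
    rw [← mul_apply_eq_comp, hπ.retractInverse_mul_fderiv hx, ← map_add, sub_add_cancel]
  | succ l ih =>
    rw [Finset.sum_range_succ, add_assoc, ih]
    congr 1
    simp only [derivTerm, derivRemainder]
    rw [pow_succ, mul_apply_eq_comp, ← map_add, ← map_add,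
      ← map_add, ← mul_apply_eq_comp (shapeOp π x), ← add_apply, ← hπ.fderiv_eq_add_shapeOp_mul hx]

lemma contDiffOn_shapeOp_pow_apply (hπ : IsTubularNbhd S ε π) {g : Euc n → Euc n}
    (hV : V ⊆ epsNbhd S ε) (hg : ContDiffOn ℝ ∞ g V) (l : ℕ) :
    ContDiffOn ℝ ∞ (fun x => (shapeOp π x ^ l) (g x)) V := by
  induction l with
  | zero => simpa using hg
  | succ l ih =>
    simp only [pow_succ', mul_apply_eq_comp]
    exact (hπ.contDiffOn_shapeOp.mono hV).clm_apply ih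

lemma contDiffOn_derivTerm (hπ : IsTubularNbhd S ε π) (hVo : IsOpen V) (hV : V ⊆ epsNbhd S ε)
    (hf : ContDiffOn ℝ ∞ f V) (v : Euc n) (l : ℕ) : ContDiffOn ℝ ∞ (derivTerm π f v l) V := by
  have h0 : ContDiffOn ℝ ∞ (fun x => fderiv ℝ π (π x) v) V :=
    (hπ.contDiffOn_fderiv_proj.mono hV).clm_apply contDiffOn_const
  have hdf : ContDiffOn ℝ ∞ (fderiv ℝ f) V := hf.fderiv_of_isOpen hVo (by simp)
  cases l with
  | zero => exact hdf.clm_apply (contDiffOn_const.sub h0)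
  | succ l =>
    exact hdf.clm_apply ((hπ.contDiffOn_retractInverse.mono hV).clm_apply
      (hπ.contDiffOn_shapeOp_pow_apply hV h0 l))

/-- The chain rule gives `Df(τ_t x) Dτ_t(x) = t ^ j Df(x)`. On `v - P₀ v`, killed by `Dπ(x)`, `Dτ_t`
is multiplication by `t`, so the degree drops by one. On tangential vectors `Dτ_t B P₀ = B(τ_t x)
P₀` preserves the degree, and every factor `A` raises it by one. -/
lemma derivTerm_fiberScale (hπ : IsTubularNbhd S ε π) (hx : x ∈ epsNbhd S ε)
    (ht : fiberScale π t x ∈ epsNbhd S ε) (hD : ∀ᶠ z in 𝓝 x, π (fiberScale π t z) = π z)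
    (ht0 : t ≠ 0) {j : ℤ} (hf : ∀ᶠ z in 𝓝 x, f (fiberScale π t z) = t ^ j • f z)
    (hfx : DifferentiableAt ℝ f x) (hft : DifferentiableAt ℝ f (fiberScale π t x))
    (v : Euc n) (l : ℕ) :
    derivTerm π f v l (fiberScale π t x) = t ^ (j - 1 + l) • derivTerm π f v l x := by
  have hp : π (fiberScale π t x) = π x := hD.self_of_nhds
  have hdf : ∀ w, fderiv ℝ f (fiberScale π t x) ((fderiv ℝ π x + t • (1 - fderiv ℝ π x)) w) =
      t ^ j • fderiv ℝ f x w := by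
    have h1 := hft.hasFDerivAt.comp x (hπ.hasFDerivAt_fiberScale hx t)
    have h2 := h1.unique ((hfx.hasFDerivAt.const_smul (t ^ j)).congr_of_eventuallyEq hf)
    intro w
    exact DFunLike.congr_fun h2 w
  cases l with
  | zero =>
    simp only [derivTerm, hp]
    have h1 : fderiv ℝ π x (v - fderiv ℝ π (π x) v) = 0 := by
      rw [map_sub, ← mul_apply_eq_comp, hπ.fderiv_mul_fderiv_proj hx, sub_self]
    have h2 := hdf (v - fderiv ℝ π (π x) v)
    simp only [add_apply, smul_apply, sub_apply, one_apply_eq_self, h1, zero_add, sub_zero,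
      map_smul] at h2
    rw [Nat.cast_zero, add_zero, zpow_sub_one₀ ht0, mul_comm, mul_smul, ← h2, inv_smul_smul₀ ht0]
  | succ l =>
    simp only [derivTerm, hp]
    have h1 : retractInverse π (fiberScale π t x) * (shapeOp π (fiberScale π t x) ^ l *
        fderiv ℝ π (π x)) = t ^ l • ((fderiv ℝ π x + t • (1 - fderiv ℝ π x)) *
          (retractInverse π x * (shapeOp π x ^ l * fderiv ℝ π (π x)))) := by
      rw [hπ.shapeOp_pow_fiberScale hx ht hD, ← ((hπ.commute_proj_shapeOp hx).pow_right l).eq,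
        clm_mul_smul, ← mul_assoc, hπ.retractInverse_fiberScale hx ht hD]
      simp only [mul_assoc]
    have h2 := congrArg (fun T => fderiv ℝ f (fiberScale π t x) (T v)) h1
    simp only [mul_apply_eq_comp, smul_apply, map_smul] at h2
    rw [h2, hdf, smul_smul]
    congr 1
    rw [← zpow_natCast, ← zpow_add₀ ht0]
    congr 1
    push_cast
    ring

end IsTubularNbhd

end DerivTerm

end ShapeOperator

/-! ### Composition rules for smoothness on subsets. -/

section SmoothOnSet

variable {D E G : Type*} [NormedAddCommGroup D] [NormedSpace ℝ D] [NormedAddCommGroup E]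
  [NormedSpace ℝ E] [NormedAddCommGroup G] [NormedSpace ℝ G]

lemma SmoothOnSet.comp_contDiffOn {f : E → G} {T : Set E} {c : D → E} {W : Set D}
    (hf : SmoothOnSet f T) (hW : IsOpen W) (hc : ContDiffOn ℝ ∞ c W) (hcT : Set.MapsTo c W T) :
    ContDiffOn ℝ ∞ (fun x => f (c x)) W := by
  intro x hx
  obtain ⟨V, hVo, hxV, g, hg, hfg⟩ := hf (c x) (hcT hx)
  have h1 : ContDiffAt ℝ ∞ (fun y => g (c y)) x :=
    (hg.contDiffAt (hVo.mem_nhds hxV)).comp x (hc.contDiffAt (hW.mem_nhds hx))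
  refine (h1.congr_of_eventuallyEq ?_).contDiffWithinAt
  filter_upwards [hW.mem_nhds hx,
    (hc.continuousOn.continuousAt (hW.mem_nhds hx)).preimage_mem_nhds (hVo.mem_nhds hxV)]
    with y hy hyV using hfg _ ⟨hcT hy, hyV⟩

lemma _root_.ContDiffOn.comp_smoothOnSet {f : E → G} {W : Set E} {c : D → E} {T : Set D}
    (hf : ContDiffOn ℝ ∞ f W) (hW : IsOpen W) (hc : SmoothOnSet c T) (hcW : Set.MapsTo c T W) :
    SmoothOnSet (fun x => f (c x)) T := by
  intro x hx
  obtain ⟨V, hVo, hxV, g, hg, hcg⟩ := hc x hx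
  refine ⟨V ∩ g ⁻¹' W, hg.continuousOn.isOpen_inter_preimage hVo hW,
    ⟨hxV, ?_⟩, fun y => f (g y), hf.comp (hg.mono Set.inter_subset_left) fun y hy => hy.2, ?_⟩
  · rw [Set.mem_preimage, ← hcg x ⟨hx, hxV⟩]
    exact hcW hx
  · intro y hy
    exact congrArg f (hcg y ⟨hy.1, hy.2.1⟩)

lemma SmoothOnSet.comp_contDiff {f : E → G} {T : Set E} {c : D → E} {T' : Set D}
    (hf : SmoothOnSet f T) (hc : ContDiff ℝ ∞ c) (hcT : Set.MapsTo c T' T) :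
    SmoothOnSet (fun x => f (c x)) T' := by
  intro x hx
  obtain ⟨V, hVo, hxV, g, hg, hfg⟩ := hf (c x) (hcT hx)
  exact ⟨c ⁻¹' V, hVo.preimage hc.continuous, hxV, fun y => g (c y),
    hg.comp hc.contDiffOn fun y hy => hy, fun y hy => hfg _ ⟨hcT hy.1, hy.2⟩⟩

lemma _root_.ContDiffOn.zpow {W : Set E} {f : E → ℝ} (hf : ContDiffOn ℝ ∞ f W)
    (h0 : ∀ x ∈ W, f x ≠ 0) (j : ℤ) : ContDiffOn ℝ ∞ (fun x => f x ^ j) W := by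
  cases j with
  | ofNat k => simpa using hf.pow k
  | negSucc k =>
    simp only [zpow_negSucc]
    exact (hf.pow (k + 1)).inv fun x hx => pow_ne_zero _ (h0 x hx)

end SmoothOnSet

/-! ### Tube coordinates invert the tube map. -/

section TubeCoordinates

variable {n d : ℕ} {S : Set (Euc n)} {ε : Euc n → ℝ} {π : Euc n → Euc n} {U : ℕ → Set (Euc n)}
  {frame : ℕ → Fin d → Euc n → Euc n} {r : ℕ → ℝ} {ν : ℕ} {x ξ : Euc n} {σ : Euc d} {ρ t : ℝ}

namespace IsTubularCover

lemma diff_subset (hU : IsTubularCover S ε U frame r) : U ν \ S ⊆ epsNbhd S ε :=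
  Set.sdiff_subset.trans (hU.subset ν)

lemma isOpen_diff (hU : IsTubularCover S ε U frame r) (hS : IsClosed S) : IsOpen (U ν \ S) :=
  (hU.isOpen ν).sdiff hS

lemma sum_frame_mem_normalSpace (hU : IsTubularCover S ε U frame r) (hξ : ξ ∈ S ∩ U ν)
    (σ : Euc d) : ∑ j, σ j • frame ν j ξ ∈ normalSpace S ξ := by
  rw [← hU.frame_span ν ξ hξ]
  exact Submodule.sum_mem _ fun j _ =>
    Submodule.smul_mem _ _ (Submodule.subset_span (Set.mem_range_self j))

lemma norm_sum_frame (hU : IsTubularCover S ε U frame r) (hξ : ξ ∈ S ∩ U ν) (σ : Euc d) :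
    ‖∑ j, σ j • frame ν j ξ‖ = ‖σ‖ := by
  have h := (hU.frame_orthonormal ν ξ hξ).inner_sum (fun j => σ j) (fun j => σ j) Finset.univ
  rw [real_inner_self_eq_norm_sq] at h
  rw [← Real.sqrt_sq (norm_nonneg (∑ j, σ j • frame ν j ξ)), h, EuclideanSpace.norm_eq σ]
  congr 1
  refine Finset.sum_congr rfl fun j _ => ?_
  simp [sq]

/-- The cover makes the tube map bijective, but that its base point is the nearest point comes from
`proj_add_smul_normal`: the whole segment from `ξ` stays in the tubular neighbourhood, as all
smaller positive radii also land in `U ν`. -/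
lemma proj_tubeMap (hU : IsTubularCover S ε U frame r) (hπ : IsTubularNbhd S ε π)
    (hξ : ξ ∈ S ∩ U ν) (hσ : σ ∈ Metric.sphere (0 : Euc d) 1) (hρ : ρ ∈ Set.Ioo 0 (r ν)) :
    π (tubeMap (frame ν) (ξ, σ, ρ)) = ξ := by
  refine hπ.proj_add_smul_normal hξ.1 (hU.sum_frame_mem_normalSpace hξ σ) (b := ρ) ?_ ρ
    ⟨hρ.1.le, le_rfl⟩
  intro s hs
  rcases hs.1.eq_or_lt with h | h
  · simpa [← h] using hπ.mem_epsNbhd hξ.1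
  · exact hU.diff_subset ((hU.diffeo ν).1.mapsTo
      (x := (ξ, σ, s)) ⟨hξ, hσ, h, hs.2.trans_lt hρ.2⟩)

lemma rhoCoord_tubeMap (hU : IsTubularCover S ε U frame r) (hπ : IsTubularNbhd S ε π)
    (hξ : ξ ∈ S ∩ U ν) (hσ : σ ∈ Metric.sphere (0 : Euc d) 1) (hρ : ρ ∈ Set.Ioo 0 (r ν)) :
    rhoCoord π (tubeMap (frame ν) (ξ, σ, ρ)) = ρ := by
  rw [rhoCoord, hU.proj_tubeMap hπ hξ hσ hρ]
  simp only [tubeMap, add_sub_cancel_left]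
  rw [norm_smul, hU.norm_sum_frame hξ, mem_sphere_zero_iff_norm.1 hσ, mul_one,
    Real.norm_of_nonneg hρ.1.le]

lemma omegaCoord_tubeMap (hU : IsTubularCover S ε U frame r) (hπ : IsTubularNbhd S ε π)
    (hξ : ξ ∈ S ∩ U ν) (hσ : σ ∈ Metric.sphere (0 : Euc d) 1) (hρ : ρ ∈ Set.Ioo 0 (r ν)) :
    omegaCoord π (frame ν) (tubeMap (frame ν) (ξ, σ, ρ)) = σ := by
  have h1 := hU.rhoCoord_tubeMap hπ hξ hσ hρ
  rw [rhoCoord] at h1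
  ext k
  simp only [omegaCoord, h1]
  rw [hU.proj_tubeMap hπ hξ hσ hρ]
  simp only [tubeMap, add_sub_cancel_left]
  rw [inner_smul_right, (hU.frame_orthonormal ν ξ hξ).inner_right_fintype]
  field_simp [hρ.1.ne']

lemma tubeCoord_mem (hU : IsTubularCover S ε U frame r) (hπ : IsTubularNbhd S ε π)
    (hx : x ∈ U ν \ S) :
    π x ∈ S ∩ U ν ∧ omegaCoord π (frame ν) x ∈ Metric.sphere (0 : Euc d) 1 ∧
      rhoCoord π x ∈ Set.Ioo 0 (r ν) ∧
      tubeMap (frame ν) (π x, omegaCoord π (frame ν) x, rhoCoord π x) = x := by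
  obtain ⟨⟨ξ, σ, ρ⟩, ⟨hξ, hσ, hρ⟩, rfl⟩ := (hU.diffeo ν).1.surjOn hx
  rw [hU.proj_tubeMap hπ hξ hσ hρ, hU.rhoCoord_tubeMap hπ hξ hσ hρ,
    hU.omegaCoord_tubeMap hπ hξ hσ hρ]
  exact ⟨hξ, hσ, hρ, rfl⟩

lemma fiberScale_eq_tubeMap (hU : IsTubularCover S ε U frame r) (hπ : IsTubularNbhd S ε π)
    (hx : x ∈ U ν \ S) (t : ℝ) :
    fiberScale π t x =
      tubeMap (frame ν) (π x, omegaCoord π (frame ν) x, t * rhoCoord π x) := by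
  obtain ⟨-, -, -, h⟩ := hU.tubeCoord_mem hπ hx
  simp only [tubeMap] at h ⊢
  have h' := eq_sub_of_add_eq' h
  rw [fiberScale, mul_smul, h']

lemma fiberScale_mem (hU : IsTubularCover S ε U frame r) (hπ : IsTubularNbhd S ε π)
    (hx : x ∈ U ν \ S) (ht : 0 < t) (htr : t * rhoCoord π x < r ν) :
    fiberScale π t x ∈ U ν \ S := by
  obtain ⟨h1, h2, h3, -⟩ := hU.tubeCoord_mem hπ hx
  rw [hU.fiberScale_eq_tubeMap hπ hx]
  exact (hU.diffeo ν).1.mapsTo ⟨h1, h2, mul_pos ht h3.1, htr⟩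

lemma proj_fiberScale (hU : IsTubularCover S ε U frame r) (hπ : IsTubularNbhd S ε π)
    (hx : x ∈ U ν \ S) (ht : 0 < t) (htr : t * rhoCoord π x < r ν) :
    π (fiberScale π t x) = π x := by
  obtain ⟨h1, h2, h3, -⟩ := hU.tubeCoord_mem hπ hx
  rw [hU.fiberScale_eq_tubeMap hπ hx]
  exact hU.proj_tubeMap hπ h1 h2 ⟨mul_pos ht h3.1, htr⟩

lemma rhoCoord_fiberScale (hU : IsTubularCover S ε U frame r) (hπ : IsTubularNbhd S ε π)
    (hx : x ∈ U ν \ S) (ht : 0 < t) (htr : t * rhoCoord π x < r ν) :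
    rhoCoord π (fiberScale π t x) = t * rhoCoord π x := by
  obtain ⟨h1, h2, h3, -⟩ := hU.tubeCoord_mem hπ hx
  rw [hU.fiberScale_eq_tubeMap hπ hx]
  exact hU.rhoCoord_tubeMap hπ h1 h2 ⟨mul_pos ht h3.1, htr⟩

lemma omegaCoord_fiberScale (hU : IsTubularCover S ε U frame r) (hπ : IsTubularNbhd S ε π)
    (hx : x ∈ U ν \ S) (ht : 0 < t) (htr : t * rhoCoord π x < r ν) :
    omegaCoord π (frame ν) (fiberScale π t x) = omegaCoord π (frame ν) x := by
  obtain ⟨h1, h2, h3, -⟩ := hU.tubeCoord_mem hπ hx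
  rw [hU.fiberScale_eq_tubeMap hπ hx]
  exact hU.omegaCoord_tubeMap hπ h1 h2 ⟨mul_pos ht h3.1, htr⟩

lemma contDiffOn_rhoCoord (hU : IsTubularCover S ε U frame r) (hπ : IsTubularNbhd S ε π) :
    ContDiffOn ℝ ∞ (rhoCoord π) (U ν \ S) := by
  refine ContDiffOn.norm ℝ (contDiffOn_id.sub (hπ.smooth.mono hU.diff_subset)) fun x hx => ?_
  exact norm_pos_iff.1 (hU.tubeCoord_mem hπ hx).2.2.1.1

/-- Openness makes the dilation identities hold on a neighbourhood, so that they can be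
differentiated. -/
lemma isOpen_rhoCoord_lt (hU : IsTubularCover S ε U frame r) (hπ : IsTubularNbhd S ε π)
    (hS : IsClosed S) (t : ℝ) : IsOpen {x | x ∈ U ν \ S ∧ t * rhoCoord π x < r ν} :=
  ((continuousOn_const.mul (hU.contDiffOn_rhoCoord hπ).continuousOn).isOpen_inter_preimage
    (hU.isOpen_diff hS) (isOpen_Iio (a := r ν)))

lemma contDiffOn_omegaCoord (hU : IsTubularCover S ε U frame r) (hπ : IsTubularNbhd S ε π)
    (hS : IsClosed S) : ContDiffOn ℝ ∞ (omegaCoord π (frame ν)) (U ν \ S) := by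
  rw [contDiffOn_euclidean]
  intro k
  have hp : ContDiffOn ℝ ∞ π (U ν \ S) := hπ.smooth.mono hU.diff_subset
  have h1 : ContDiffOn ℝ ∞ (fun x => frame ν k (π x)) (U ν \ S) :=
    (hU.frame_smooth ν k).comp_contDiffOn (hU.isOpen_diff hS) hp
      fun x hx => (hU.tubeCoord_mem hπ hx).1
  exact (h1.inner ℝ (contDiffOn_id.sub hp)).div (hU.contDiffOn_rhoCoord hπ)
    fun x hx => (hU.tubeCoord_mem hπ hx).2.2.1.1.ne'

end IsTubularCover

end TubeCoordinates

/-! ### Fibre-homogeneous functions and expansion terms. -/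

section Homogeneous

variable {n d : ℕ} {S : Set (Euc n)} {ε : Euc n → ℝ} {π : Euc n → Euc n} {U : ℕ → Set (Euc n)}
  {frame : ℕ → Fin d → Euc n → Euc n} {r : ℕ → ℝ} {ν : ℕ} {x ξ : Euc n} {σ : Euc d} {ρ t : ℝ}
  {E : Type*} [NormedAddCommGroup E] [NormedSpace ℝ E]

/-- `h` is homogeneous of degree `q` under the dilations in the fibres of `π`, in the tube
`W` of radius `R`. -/
def IsFiberHomogeneous (π : Euc n → Euc n) (W : Set (Euc n)) (R : ℝ) (q : ℤ) (h : Euc n → E) :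
    Prop :=
  ∀ x ∈ W, ∀ t : ℝ, 0 < t → t * rhoCoord π x < R → h (fiberScale π t x) = t ^ q • h x

variable {𝕜 : Type*} [RCLike 𝕜]

lemma contDiffOn_tubeTerm (hU : IsTubularCover S ε U frame r) (hπ : IsTubularNbhd S ε π)
    (hS : IsClosed S) {a : Euc n × Euc d → 𝕜}
    (ha : SmoothOnSet a ((S ∩ U ν) ×ˢ Metric.sphere (0 : Euc d) 1)) (j : ℤ) :
    ContDiffOn ℝ ∞ (tubeTerm π (frame ν) a j) (U ν \ S) := by
  have h1 : ContDiffOn ℝ ∞ (fun x => a (π x, omegaCoord π (frame ν) x)) (U ν \ S) :=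
    ha.comp_contDiffOn (hU.isOpen_diff hS)
      ((hπ.smooth.mono hU.diff_subset).prodMk (hU.contDiffOn_omegaCoord hπ hS))
      fun x hx => ⟨(hU.tubeCoord_mem hπ hx).1, (hU.tubeCoord_mem hπ hx).2.1⟩
  exact ((hU.contDiffOn_rhoCoord hπ).zpow
    (fun x hx => (hU.tubeCoord_mem hπ hx).2.2.1.1.ne') j).smul h1

lemma isFiberHomogeneous_tubeTerm (hU : IsTubularCover S ε U frame r)
    (hπ : IsTubularNbhd S ε π) (a : Euc n × Euc d → 𝕜) (j : ℤ) :
    IsFiberHomogeneous π (U ν \ S) (r ν) j (tubeTerm π (frame ν) a j) := by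
  intro x hx t ht htr
  simp only [tubeTerm]
  rw [hU.proj_fiberScale hπ hx ht htr, hU.rhoCoord_fiberScale hπ hx ht htr,
    hU.omegaCoord_fiberScale hπ hx ht htr, mul_zpow, mul_smul]

/-- A smooth fibre-homogeneous function is of the form `a(ξ_x, ω_x) ρ_x ^ q`. -/
lemma IsFiberHomogeneous.exists_tubeTerm (hU : IsTubularCover S ε U frame r)
    (hπ : IsTubularNbhd S ε π) (hS : IsClosed S) {q : ℤ} {h : Euc n → 𝕜}
    (hh : IsFiberHomogeneous π (U ν \ S) (r ν) q h) (hsm : ContDiffOn ℝ ∞ h (U ν \ S)) :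
    ∃ b : Euc n × Euc d → 𝕜,
      SmoothOnSet b ((S ∩ U ν) ×ˢ Metric.sphere (0 : Euc d) 1) ∧
      Set.EqOn (tubeTerm π (frame ν) b q) h (U ν \ S) := by
  have hr := hU.radius_pos ν
  have hr2 : r ν / 2 ∈ Set.Ioo 0 (r ν) := ⟨half_pos hr, half_lt_self hr⟩
  -- The coefficient is read off on the tube of radius `r ν / 2`; any fixed radius in `(0, r ν)`
  -- would serve.
  refine ⟨fun p => (r ν / 2) ^ (-q) • h (tubeMap (frame ν) (p.1, p.2, r ν / 2)), ?_, ?_⟩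
  · refine (hsm.const_smul ((r ν / 2) ^ (-q))).comp_smoothOnSet (hU.isOpen_diff hS)
      (c := fun p : Euc n × Euc d => tubeMap (frame ν) (p.1, p.2, r ν / 2))
      (((hU.diffeo ν).2.1).comp_contDiff (c := fun p : Euc n × Euc d => (p.1, p.2, r ν / 2))
        (by fun_prop) fun p hp => ⟨hp.1, hp.2, hr2⟩) fun p hp => ?_
    exact (hU.diffeo ν).1.mapsTo ⟨hp.1, hp.2, hr2⟩
  · intro x hx
    have hρ := (hU.tubeCoord_mem hπ hx).2.2.1.1
    have e1 : r ν / 2 / rhoCoord π x * rhoCoord π x = r ν / 2 := div_mul_cancel₀ _ hρ.ne'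
    have e2 := hU.fiberScale_eq_tubeMap hπ hx (r ν / 2 / rhoCoord π x)
    rw [e1] at e2
    simp only [tubeTerm]
    rw [← e2, hh x hx _ (div_pos hr2.1 hρ) (by rw [e1]; exact hr2.2), smul_smul, smul_smul]
    have h3 : ∀ R s : ℝ, R ≠ 0 → s ≠ 0 → s ^ q * R ^ (-q) * (R / s) ^ q = 1 := by
      intro R s hR hs
      have h1 := zpow_ne_zero q hR
      have h2 := zpow_ne_zero q hs
      rw [div_zpow, zpow_neg]
      field_simp
    rw [h3 _ _ hr2.1.ne' hρ.ne', one_smul]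

lemma isFiberHomogeneous_derivTerm (hU : IsTubularCover S ε U frame r)
    (hπ : IsTubularNbhd S ε π) (hS : IsClosed S) {q : ℤ} {h : Euc n → E}
    (hh : IsFiberHomogeneous π (U ν \ S) (r ν) q h) (hsm : ContDiffOn ℝ ∞ h (U ν \ S))
    (v : Euc n) (l : ℕ) :
    IsFiberHomogeneous π (U ν \ S) (r ν) (q - 1 + l) (derivTerm π h v l) := by
  intro x hx t ht htr
  have hy := hU.fiberScale_mem hπ hx ht htr
  have hmem := (hU.isOpen_rhoCoord_lt hπ hS t).mem_nhds (x := x) ⟨hx, htr⟩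
  have hd : ∀ y ∈ U ν \ S, DifferentiableAt ℝ h y := fun y hy =>
    (hsm.contDiffAt ((hU.isOpen_diff hS).mem_nhds hy)).differentiableAt (by simp)
  refine hπ.derivTerm_fiberScale (hU.diff_subset hx) (hU.diff_subset hy) ?_ ht.ne' ?_
    (hd _ hx) (hd _ hy) v l
  · filter_upwards [hmem] with z hz using hU.proj_fiberScale hπ hz.1 ht hz.2
  · filter_upwards [hmem] with z hz using hh z hz.1 t ht hz.2

end Homogeneous

/-! ### Symbol estimates as the tube radius tends to zero. -/

section TubeFilter

variable {n d : ℕ} {S : Set (Euc n)} {ε : Euc n → ℝ} {π : Euc n → Euc n} {U : ℕ → Set (Euc n)}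
  {frame : ℕ → Fin d → Euc n → Euc n} {r : ℕ → ℝ} {ν : ℕ} {X K : Set (Euc n)} {x : Euc n}
  {E : Type*} [NormedAddCommGroup E] [NormedSpace ℝ E]

/-- The filter on `X` describing the limit `ρ_x → 0`. -/
noncomputable def tubeFilter (X : Set (Euc n)) (π : Euc n → Euc n) : Filter (Euc n) :=
  Filter.principal X ⊓ Filter.comap (rhoCoord π) (𝓝 0)

/-- The filter on `X` describing the limit `ρ_x → 0` with `ξ_x` confined to `K`. -/
noncomputable def tubeFilterOver (X : Set (Euc n)) (π : Euc n → Euc n) (K : Set (Euc n)) :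
    Filter (Euc n) :=
  tubeFilter X π ⊓ Filter.principal (π ⁻¹' K)

lemma eventually_tubeFilter {p : Euc n → Prop} :
    (∀ᶠ x in tubeFilter X π, p x) ↔ ∃ δ > 0, ∀ x ∈ X, rhoCoord π x < δ → p x := by
  rw [tubeFilter, inf_comm, Filter.eventually_inf_principal,
    (Metric.nhds_basis_ball.comap _).eventually_iff]
  refine exists_congr fun δ => and_congr_right fun _ => ⟨fun h x hx hd => h ?_ hx,
    fun h x hd hx => h x hx ?_⟩
  · simpa [rhoCoord] using hd
  · simpa [rhoCoord] using hd

lemma eventually_tubeFilterOver {p : Euc n → Prop} :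
    (∀ᶠ x in tubeFilterOver X π K, p x) ↔
      ∃ δ > 0, ∀ x ∈ X, rhoCoord π x < δ → π x ∈ K → p x := by
  rw [tubeFilterOver, Filter.eventually_inf_principal, eventually_tubeFilter]
  rfl

lemma mem_tubeFilter : X ∈ tubeFilter X π :=
  Filter.mem_inf_of_left (Filter.mem_principal_self X)

lemma mem_tubeFilterOver : X ∈ tubeFilterOver X π K := Filter.mem_inf_of_left mem_tubeFilter

lemma tubeFilterOver_le : tubeFilterOver X π K ≤ tubeFilter X π := inf_le_left

lemma rhoCoord_nonneg : 0 ≤ rhoCoord π x := norm_nonneg _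

lemma isBigO_tubeFilter {E : Type*} [NormedAddCommGroup E] {f : Euc n → E} {s : ℤ} :
    (f =O[tubeFilter X π] fun x => rhoCoord π x ^ s) ↔
      ∃ C δ : ℝ, 0 < δ ∧ ∀ x ∈ X, rhoCoord π x < δ → ‖f x‖ ≤ C * rhoCoord π x ^ s := by
  rw [Asymptotics.isBigO_iff]
  refine exists_congr fun C => ?_
  rw [eventually_tubeFilter]
  simp only [Real.norm_of_nonneg (zpow_nonneg rhoCoord_nonneg s)]

namespace IsTubularCover

lemma eventually_rhoCoord (hU : IsTubularCover S ε U frame r) (hπ : IsTubularNbhd S ε π)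
    (hX : X ⊆ U ν \ S) : ∀ᶠ x in tubeFilter X π, 0 < rhoCoord π x ∧ rhoCoord π x < 1 :=
  eventually_tubeFilter.2 ⟨1, one_pos, fun _ hx h1 => ⟨(hU.tubeCoord_mem hπ (hX hx)).2.2.1.1, h1⟩⟩

end IsTubularCover

namespace IsTubularNbhd

/-- Points with `ξ_x ∈ K` and small `ρ_x` lie in a compact thickening of `K ∩ S`, on which
derivatives of a function smooth across `S` are bounded. -/
lemma exists_bound_iteratedFDeriv (hπ : IsTubularNbhd S ε π) (hS : IsClosed S)
    (hX : X ⊆ epsNbhd S ε) (hK : IsCompact K) {g : Euc n → E}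
    (hg : ContDiffOn ℝ ∞ g (epsNbhd S ε)) (p : ℕ) :
    ∃ C, ∀ᶠ x in tubeFilterOver X π K, ‖iteratedFDeriv ℝ p g x‖ ≤ C := by
  have hKS : IsCompact (K ∩ S) := hK.inter_right hS
  obtain ⟨δ, hδ, hsub⟩ := hKS.exists_cthickening_subset_open isOpen_epsNbhd
    fun ξ hξ => hπ.mem_epsNbhd hξ.2
  have hcont : ContinuousOn (iteratedFDeriv ℝ p g) (epsNbhd S ε) := by
    intro x hx
    exact ((hg.contDiffAt (isOpen_epsNbhd.mem_nhds hx)).continuousAt_iteratedFDeriv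
      (by exact_mod_cast le_top)).continuousWithinAt
  obtain ⟨C, hC⟩ := hKS.cthickening.exists_bound_of_continuousOn (hcont.mono hsub)
  refine ⟨C, eventually_tubeFilterOver.2 ⟨δ, hδ, fun x hx hd hxK => hC x ?_⟩⟩
  refine Metric.mem_cthickening_of_dist_le x (π x) δ _ ⟨hxK, hπ.mem x (hX hx)⟩ ?_
  rw [dist_eq_norm]
  exact hd.le

lemma isSymbol_zero_of_contDiffOn (hπ : IsTubularNbhd S ε π) (hS : IsClosed S)
    (hX : X ⊆ epsNbhd S ε) (hK : IsCompact K) {g : Euc n → E}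
    (hg : ContDiffOn ℝ ∞ g (epsNbhd S ε))
    (hρ : ∀ᶠ x in tubeFilterOver X π K, 0 < rhoCoord π x ∧ rhoCoord π x < 1) :
    IsSymbol (tubeFilterOver X π K) (rhoCoord π) 0 g := fun p => by
  obtain ⟨C, hC⟩ := hπ.exists_bound_iteratedFDeriv hS hX hK hg p
  refine Asymptotics.IsBigO.of_bound C ?_
  filter_upwards [hC, hρ] with x h1 h2
  have hC0 : 0 ≤ C := (norm_nonneg _).trans h1
  rw [Real.norm_of_nonneg (zpow_nonneg h2.1.le _), zero_sub]
  have : 1 ≤ rhoCoord π x ^ (-(p : ℤ)) :=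
    one_le_zpow_of_nonpos₀ h2.1 h2.2.le (by lia)
  nlinarith

end IsTubularNbhd

/-- The derivatives of the dilation in the fibres are bounded by the dilation factor. -/
lemma IsTubularNbhd.exists_bound_iteratedFDeriv_fiberScale (hπ : IsTubularNbhd S ε π)
    (hS : IsClosed S) (hX : X ⊆ epsNbhd S ε) (hK : IsCompact K) (p : ℕ) :
    ∃ D : ℝ, 1 ≤ D ∧ ∀ᶠ x in tubeFilterOver X π K, ∀ t : ℝ, 1 ≤ t → ∀ i, 1 ≤ i → i ≤ p →
      ‖iteratedFDeriv ℝ i (fiberScale π t) x‖ ≤ (D * t) ^ i := by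
  choose C1 hC1 using hπ.exists_bound_iteratedFDeriv hS hX hK hπ.smooth
  choose C2 hC2 using hπ.exists_bound_iteratedFDeriv hS hX hK (contDiffOn_id.sub hπ.smooth)
  let D := 1 + ∑ i ∈ Finset.range (p + 1), (|C1 i| + |C2 i|)
  have hD : 1 ≤ D := le_add_of_nonneg_right (by positivity)
  refine ⟨D, hD, ?_⟩
  have h1 := (Filter.eventually_all_finset (Finset.range (p + 1))).2 fun i _ => hC1 i
  have h2 := (Filter.eventually_all_finset (Finset.range (p + 1))).2 fun i _ => hC2 i
  filter_upwards [h1, h2, mem_tubeFilterOver] with x h1 h2 hx t ht i hi1 hip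
  have hi : i ∈ Finset.range (p + 1) := Finset.mem_range.2 (Nat.lt_succ_of_le hip)
  have hx' := isOpen_epsNbhd.mem_nhds (hX hx)
  have c1 : ContDiffAt ℝ i π x := (hπ.smooth.contDiffAt hx').of_le (by exact_mod_cast le_top)
  have c2 : ContDiffAt ℝ i (id - π) x := contDiffAt_id.sub c1
  have e : fiberScale π t = π + t • (id - π) := rfl
  have c3 : ContDiffAt ℝ i (t • (id - π)) x := c2.const_smul t
  have hsum : |C1 i| + |C2 i| ≤ D := by
    have := Finset.single_le_sum (f := fun i => |C1 i| + |C2 i|) (fun j _ => by positivity) hi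
    simp only [D]
    linarith
  calc ‖iteratedFDeriv ℝ i (fiberScale π t) x‖
      ≤ ‖iteratedFDeriv ℝ i π x‖ + t * ‖iteratedFDeriv ℝ i (id - π) x‖ := by
        rw [e, iteratedFDeriv_add_apply c1 c3, iteratedFDeriv_const_smul_apply c2]
        refine (norm_add_le _ _).trans ?_
        rw [norm_smul, Real.norm_of_nonneg (by linarith)]
    _ ≤ |C1 i| + t * |C2 i| := by
        gcongr
        · exact (h1 i hi).trans (le_abs_self _)
        · exact (h2 i hi).trans (le_abs_self _)
    _ ≤ D * t := by nlinarith [abs_nonneg (C1 i), abs_nonneg (C2 i)]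
    -- The dilation is affine in `t`, so the linear bound suffices; the weaker power is the form
    -- required by the composition estimate.
    _ ≤ (D * t) ^ i := le_self_pow₀ (one_le_mul_of_one_le_of_one_le hD ht) (by lia)

/-- A fibre-homogeneous symbol of any order is a symbol of order its degree of homogeneity. -/
lemma IsFiberHomogeneous.isSymbol (hU : IsTubularCover S ε U frame r)
    (hπ : IsTubularNbhd S ε π) (hS : IsClosed S) {Ω : Set (Euc n)} (hΩ : IsOpen Ω)
    (hK : IsCompact K) (hKΩ : K ⊆ Ω) {q s : ℤ} {h : Euc n → E}
    (hh : IsFiberHomogeneous π (U ν \ S) (r ν) q h) (hsm : ContDiffOn ℝ ∞ h (U ν \ S))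
    (hs : IsSymbol (tubeFilterOver ((Ω ∩ U ν) \ S) π K) (rhoCoord π) s h) :
    IsSymbol (tubeFilterOver ((Ω ∩ U ν) \ S) π K) (rhoCoord π) q h := fun p => by
  have hXW : (Ω ∩ U ν) \ S ⊆ U ν \ S := fun x hx => ⟨hx.1.2, hx.2⟩
  obtain ⟨D, hD1, hD⟩ := hπ.exists_bound_iteratedFDeriv_fiberScale hS
    (hXW.trans hU.diff_subset) hK p
  choose C hC using fun i => (hs i).bound
  have hC' := (Filter.eventually_all_finset (Finset.range (p + 1))).2 fun i _ => hC i
  obtain ⟨δ₁, hδ₁, hb⟩ := eventually_tubeFilterOver.1 (hC'.and hD)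
  obtain ⟨δ₂, hδ₂, hsub⟩ := hK.exists_cthickening_subset_open hΩ hKΩ
  -- The reference radius `c` is small enough for the assumed bounds to hold (`δ₁`), for dilated
  -- points to stay in `Ω` (`δ₂`), and for them to stay in the tube (`r ν`).
  obtain ⟨c, hc0, hc⟩ : ∃ c, 0 < c ∧ c < min (min δ₁ δ₂) (r ν) :=
    exists_between (lt_min (lt_min hδ₁ hδ₂) (hU.radius_pos ν))
  have hcδ₁ : c < δ₁ := hc.trans_le ((min_le_left _ _).trans (min_le_left _ _))
  have hcδ₂ : c < δ₂ := hc.trans_le ((min_le_left _ _).trans (min_le_right _ _))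
  have hcr : c < r ν := hc.trans_le (min_le_right _ _)
  let M := ∑ i ∈ Finset.range (p + 1), |C i| * c ^ (s - i)
  refine Asymptotics.IsBigO.of_bound (p.factorial * M * D ^ p * c ^ (p - q : ℤ)) ?_
  refine eventually_tubeFilterOver.2 ⟨c, hc0, fun x hx hxc hxK => ?_⟩
  have hxW := hXW hx
  have hρ : 0 < rhoCoord π x := (hU.tubeCoord_mem hπ hxW).2.2.1.1
  -- This dilation moves `x` to radius exactly `c`, where the given symbol bounds become constants.
  -- Pulling back costs `t ^ p` by the chain rule and gains `t ^ (-q)` by homogeneity, for a total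
  -- of order `ρ ^ (q - p)`.
  let t := c / rhoCoord π x
  have ht1 : 1 ≤ t := (one_le_div hρ).2 hxc.le
  have ht0 : 0 < t := one_pos.trans_le ht1
  have htc : t * rhoCoord π x = c := div_mul_cancel₀ _ hρ.ne'
  have htr : t * rhoCoord π x < r ν := htc.trans_lt hcr
  let W' := {x | x ∈ U ν \ S ∧ t * rhoCoord π x < r ν}
  have hW' : IsOpen W' := hU.isOpen_rhoCoord_lt hπ hS t
  have hxW' : x ∈ W' := ⟨hxW, htr⟩
  have hyW := hU.fiberScale_mem hπ hxW ht0 htr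
  have hyρ : rhoCoord π (fiberScale π t x) = c := by
    rw [hU.rhoCoord_fiberScale hπ hxW ht0 htr, htc]
  have hyπ : π (fiberScale π t x) = π x := hU.proj_fiberScale hπ hxW ht0 htr
  have hyX : fiberScale π t x ∈ (Ω ∩ U ν) \ S := by
    refine ⟨⟨hsub (Metric.mem_cthickening_of_dist_le _ (π x) δ₂ _ hxK ?_), hyW.1⟩, hyW.2⟩
    rw [dist_eq_norm]
    rw [rhoCoord, hyπ] at hyρ
    exact hyρ.trans_le hcδ₂.le
  have hyb := (hb _ hyX (hyρ.trans_lt hcδ₁) (by rwa [hyπ])).1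
  have hxb := (hb x hx (hxc.trans hcδ₁) hxK).2 t ht1
  have hM : ∀ i ≤ p, ‖iteratedFDeriv ℝ i h (fiberScale π t x)‖ ≤ M := by
    intro i hi
    have hi' : i ∈ Finset.range (p + 1) := Finset.mem_range.2 (Nat.lt_succ_of_le hi)
    have h1 := hyb i hi'
    rw [hyρ, Real.norm_of_nonneg (zpow_nonneg hc0.le _)] at h1
    refine h1.trans ((mul_le_mul_of_nonneg_right (le_abs_self _) (zpow_nonneg hc0.le _)).trans ?_)
    exact Finset.single_le_sum (f := fun i : ℕ => |C i| * c ^ (s - i))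
      (fun j _ => mul_nonneg (abs_nonneg _) (zpow_nonneg hc0.le _)) hi'
  have hWo := hU.isOpen_diff (ν := ν) hS
  have hcomp : ‖iteratedFDeriv ℝ p (h ∘ fiberScale π t) x‖ ≤ p.factorial * M * (D * t) ^ p := by
    have hf : ContDiffOn ℝ ∞ (fiberScale π t) W' :=
      (hπ.contDiffOn_fiberScale t).mono fun y hy => hU.diff_subset hy.1
    have hmaps : Set.MapsTo (fiberScale π t) W' (U ν \ S) :=
      fun y hy => hU.fiberScale_mem hπ hy.1 ht0 hy.2
    have := norm_iteratedFDerivWithin_comp_le hsm hf (n := p) (by exact_mod_cast le_top)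
      hWo.uniqueDiffOn hW'.uniqueDiffOn hmaps hxW' (C := M) (D := D * t)
      (fun i hi => by
        rw [iteratedFDerivWithin_of_isOpen _ hWo hyW]
        exact hM i hi)
      (fun i hi1 hi => by
        rw [iteratedFDerivWithin_of_isOpen _ hW' hxW']
        exact hxb i hi1 hi)
    rwa [iteratedFDerivWithin_of_isOpen _ hW' hxW'] at this
  have heq : h =ᶠ[𝓝 x] t ^ (-q) • (h ∘ fiberScale π t) := by
    filter_upwards [hW'.mem_nhds hxW'] with y hy
    simp only [Pi.smul_apply, Function.comp_apply]
    rw [hh y hy.1 t ht0 hy.2, smul_smul, zpow_neg, inv_mul_cancel₀ (zpow_ne_zero q ht0.ne'),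
      one_smul]
  have hcd : ContDiffAt ℝ p (h ∘ fiberScale π t) x :=
    ((hsm.contDiffAt (hWo.mem_nhds hyW)).comp x ((hπ.contDiffOn_fiberScale t).contDiffAt
      (isOpen_epsNbhd.mem_nhds (hU.diff_subset hxW)))).of_le (by exact_mod_cast le_top)
  rw [(heq.iteratedFDeriv ℝ p).eq_of_nhds, iteratedFDeriv_const_smul_apply hcd, norm_smul,
    Real.norm_of_nonneg (zpow_nonneg ht0.le _), Real.norm_of_nonneg (zpow_nonneg hρ.le _)]
  calc t ^ (-q) * ‖iteratedFDeriv ℝ p (h ∘ fiberScale π t) x‖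
      ≤ t ^ (-q) * (p.factorial * M * (D * t) ^ p) := by gcongr
    _ = p.factorial * M * D ^ p * t ^ (p - q : ℤ) := by
        rw [mul_pow, sub_eq_add_neg, zpow_add₀ ht0.ne', zpow_natCast]
        ring
    _ = p.factorial * M * D ^ p * c ^ (p - q : ℤ) * rhoCoord π x ^ (q - p : ℤ) := by
        rw [div_zpow, ← neg_sub (p : ℤ) q, zpow_neg, div_eq_mul_inv]
        ring

end TubeFilter

/-! ### Uniform error bounds for the derivative expansion. -/

section Expansion

variable {n d : ℕ} {S : Set (Euc n)} {ε : Euc n → ℝ} {π : Euc n → Euc n} {U : ℕ → Set (Euc n)}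
  {frame : ℕ → Fin d → Euc n → Euc n} {r : ℕ → ℝ} {ν : ℕ} {Ω K : Set (Euc n)} {x : Euc n}
  {E : Type*} [NormedAddCommGroup E] [NormedSpace ℝ E]

lemma isFiberHomogeneous_shapeOp (hU : IsTubularCover S ε U frame r)
    (hπ : IsTubularNbhd S ε π) (hS : IsClosed S) :
    IsFiberHomogeneous π (U ν \ S) (r ν) 1 (shapeOp π) := by
  intro x hx t ht htr
  have hy := hU.fiberScale_mem hπ hx ht htr
  have hmem := (hU.isOpen_rhoCoord_lt hπ hS t).mem_nhds (x := x) ⟨hx, htr⟩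
  have h1 := hπ.shapeOp_mul_proj (hU.diff_subset hy)
  rw [hU.proj_fiberScale hπ hx ht htr, hπ.shapeOp_fiberScale (hU.diff_subset hx)
    (hU.diff_subset hy) (by
      filter_upwards [hmem] with z hz using hU.proj_fiberScale hπ hz.1 ht hz.2),
    hπ.shapeOp_mul_proj (hU.diff_subset hx)] at h1
  rw [← h1, zpow_one]

/-- Smoothness across `S` gives order `0`; homogeneity of degree `1` improves this to order `1`. -/
lemma isSymbol_shapeOp (hU : IsTubularCover S ε U frame r)
    (hπ : IsTubularNbhd S ε π) (hS : IsClosed S) (hΩ : IsOpen Ω)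
    (hK : IsCompact K) (hKΩ : K ⊆ Ω) :
    IsSymbol (tubeFilterOver ((Ω ∩ U ν) \ S) π K) (rhoCoord π) 1 (shapeOp π) := by
  have hXW : (Ω ∩ U ν) \ S ⊆ U ν \ S := fun x hx => ⟨hx.1.2, hx.2⟩
  exact (isFiberHomogeneous_shapeOp hU hπ hS).isSymbol hU hπ hS hΩ hK hKΩ
    (hπ.contDiffOn_shapeOp.mono hU.diff_subset)
    (hπ.isSymbol_zero_of_contDiffOn hS (hXW.trans hU.diff_subset) hK hπ.contDiffOn_shapeOp
      ((hU.eventually_rhoCoord hπ hXW).filter_mono tubeFilterOver_le))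

lemma isSymbol_fderiv_retractInverse (hU : IsTubularCover S ε U frame r)
    (hπ : IsTubularNbhd S ε π) (hS : IsClosed S) (hΩ : IsOpen Ω)
    (hK : IsCompact K) (hKΩ : K ⊆ Ω) {h : Euc n → E} (hsm : ContDiffOn ℝ ∞ h (U ν \ S)) {s : ℤ}
    (hs : IsSymbol (tubeFilterOver ((Ω ∩ U ν) \ S) π K) (rhoCoord π) s h)
    {g : Euc n → Euc n} (hg : ContDiffOn ℝ ∞ g (epsNbhd S ε)) (l : ℕ) :
    IsSymbol (tubeFilterOver ((Ω ∩ U ν) \ S) π K) (rhoCoord π) (s - 1 + l)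
      (fun x => fderiv ℝ h x (retractInverse π x ((shapeOp π x ^ l) (g x)))) := by
  have hXW : (Ω ∩ U ν) \ S ⊆ U ν \ S := fun x hx => ⟨hx.1.2, hx.2⟩
  have hXo : IsOpen ((Ω ∩ U ν) \ S) := (hΩ.inter (hU.isOpen ν)).sdiff hS
  have hXN := hXW.trans hU.diff_subset
  have hρ := (hU.eventually_rhoCoord hπ hXW).filter_mono (tubeFilterOver_le (K := K))
  have hρ0 := hρ.mono fun _ h => h.1
  have hgX := hg.mono hXN
  have hpow : IsSymbol (tubeFilterOver ((Ω ∩ U ν) \ S) π K) (rhoCoord π) l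
      (fun x => (shapeOp π x ^ l) (g x)) := by
    induction l with
    | zero => simpa using hπ.isSymbol_zero_of_contDiffOn hS hXN hK hg hρ
    | succ l ih =>
      simp only [pow_succ', mul_apply_eq_comp]
      have := (isSymbol_shapeOp hU hπ hS hΩ hK hKΩ).clm_apply hρ0 hXo mem_tubeFilterOver
        (hπ.contDiffOn_shapeOp.mono hXN) (hπ.contDiffOn_shapeOp_pow_apply hXN hgX l) ih
      rwa [add_comm, ← Nat.cast_one, ← Nat.cast_add] at this
  have h1 := (hπ.isSymbol_zero_of_contDiffOn hS hXN hK hπ.contDiffOn_retractInverse hρ).clm_apply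
    hρ0 hXo mem_tubeFilterOver (hπ.contDiffOn_retractInverse.mono hXN)
    (hπ.contDiffOn_shapeOp_pow_apply hXN hgX l) hpow
  rw [zero_add] at h1
  exact hs.fderiv.clm_apply hρ0 hXo mem_tubeFilterOver
    ((hsm.mono hXW).fderiv_of_isOpen hXo (by simp))
    ((hπ.contDiffOn_retractInverse.mono hXN).clm_apply
      (hπ.contDiffOn_shapeOp_pow_apply hXN hgX l)) h1

/-- Any order is enough here, since homogeneity later replaces it by the sharp one. For tangential
terms the product rule alone would fall one short. -/
lemma exists_isSymbol_derivTerm (hU : IsTubularCover S ε U frame r)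
    (hπ : IsTubularNbhd S ε π) (hS : IsClosed S) (hΩ : IsOpen Ω)
    (hK : IsCompact K) (hKΩ : K ⊆ Ω) {h : Euc n → E} (hsm : ContDiffOn ℝ ∞ h (U ν \ S)) {s : ℤ}
    (hs : IsSymbol (tubeFilterOver ((Ω ∩ U ν) \ S) π K) (rhoCoord π) s h) (v : Euc n) (l : ℕ) :
    ∃ t, IsSymbol (tubeFilterOver ((Ω ∩ U ν) \ S) π K) (rhoCoord π) t (derivTerm π h v l) := by
  have hXW : (Ω ∩ U ν) \ S ⊆ U ν \ S := fun x hx => ⟨hx.1.2, hx.2⟩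
  have hXo : IsOpen ((Ω ∩ U ν) \ S) := (hΩ.inter (hU.isOpen ν)).sdiff hS
  have hXN := hXW.trans hU.diff_subset
  have hρ := (hU.eventually_rhoCoord hπ hXW).filter_mono (tubeFilterOver_le (K := K))
  have hρ0 := hρ.mono fun _ h => h.1
  have hP : ContDiffOn ℝ ∞ (fun x => fderiv ℝ π (π x) v) (epsNbhd S ε) :=
    hπ.contDiffOn_fderiv_proj.clm_apply contDiffOn_const
  cases l with
  | zero =>
    have hQ : ContDiffOn ℝ ∞ (fun x => v - fderiv ℝ π (π x) v) (epsNbhd S ε) :=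
      contDiffOn_const.sub hP
    exact ⟨_, hs.fderiv.clm_apply hρ0 hXo mem_tubeFilterOver
      ((hsm.mono hXW).fderiv_of_isOpen hXo (by simp)) (hQ.mono hXN)
      (hπ.isSymbol_zero_of_contDiffOn hS hXN hK hQ hρ)⟩
  | succ l => exact ⟨_, isSymbol_fderiv_retractInverse hU hπ hS hΩ hK hKΩ hsm hs hP l⟩

/-- The derivative of a homogeneous symbol of degree `j` is, up to a symbol of order `j - 1 + M`,
the sum of the first `M` terms of its expansion. -/
lemma isSymbol_fderiv_sub_sum_derivTerm (hU : IsTubularCover S ε U frame r)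
    (hπ : IsTubularNbhd S ε π) (hS : IsClosed S) (hΩ : IsOpen Ω)
    (hK : IsCompact K) (hKΩ : K ⊆ Ω) {h : Euc n → E} (hsm : ContDiffOn ℝ ∞ h (U ν \ S)) {j : ℤ}
    (hh : IsFiberHomogeneous π (U ν \ S) (r ν) j h)
    (hs : IsSymbol (tubeFilterOver ((Ω ∩ U ν) \ S) π K) (rhoCoord π) j h) (v : Euc n) (M : ℕ) :
    IsSymbol (tubeFilterOver ((Ω ∩ U ν) \ S) π K) (rhoCoord π) (j - 1 + M)
      (fun x => fderiv ℝ h x v - ∑ l ∈ Finset.range M, derivTerm π h v l x) := by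
  have hXW : (Ω ∩ U ν) \ S ⊆ U ν \ S := fun x hx => ⟨hx.1.2, hx.2⟩
  have hXo : IsOpen ((Ω ∩ U ν) \ S) := (hΩ.inter (hU.isOpen ν)).sdiff hS
  have hXN := hXW.trans hU.diff_subset
  have hT : ContDiffOn ℝ ∞ (derivTerm π h v M) (U ν \ S) :=
    hπ.contDiffOn_derivTerm (hU.isOpen_diff hS) hU.diff_subset hsm v M
  obtain ⟨t, ht⟩ := exists_isSymbol_derivTerm hU hπ hS hΩ hK hKΩ hsm hs v M
  have h1 := (isFiberHomogeneous_derivTerm hU hπ hS hh hsm v M).isSymbol hU hπ hS hΩ hK hKΩ hT ht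
  have hP : ContDiffOn ℝ ∞ (fun x => fderiv ℝ π x v) (epsNbhd S ε) :=
    hπ.contDiffOn_fderiv.clm_apply contDiffOn_const
  have h2 := isSymbol_fderiv_retractInverse hU hπ hS hΩ hK hKΩ hsm hs hP M
  -- The product rule puts the exact remainder after `M + 1` terms only at order `j - 1 + M`. Term
  -- number `M` has that same order by homogeneity, so it joins the error.
  have h3 := h1.add hXo mem_tubeFilterOver (hT.mono hXW)
    (((hsm.mono hXW).fderiv_of_isOpen hXo (by simp)).clm_apply
      ((hπ.contDiffOn_retractInverse.mono hXN).clm_apply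
        (hπ.contDiffOn_shapeOp_pow_apply hXN (hP.mono hXN) M))) h2
  refine h3.congr hXo mem_tubeFilterOver fun x hx => ?_
  rw [hπ.fderiv_eq_sum_derivTerm (hXN hx) h v M, Finset.sum_range_succ, derivRemainder]
  abel

lemma derivTerm_eventuallyEq_zero {h : Euc n → E} (hh : h =ᶠ[𝓝 x] 0) (v : Euc n) (l : ℕ) :
    derivTerm π h v l =ᶠ[𝓝 x] 0 := by
  have h0 : fderiv ℝ h =ᶠ[𝓝 x] 0 := by
    have := hh.fderiv (𝕜 := ℝ)
    simpa using this
  filter_upwards [h0] with y hy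
  cases l <;> simp [derivTerm, hy]

end Expansion

/-! ### Cutoff functions near a compact set. -/

section Cutoff

variable {n : ℕ} {K Ω : Set (Euc n)}

/-- A smooth function which is one near `K` and zero outside a compact subset of `Ω`. -/
lemma exists_cutoff (hK : IsCompact K) (hΩ : IsOpen Ω) (hKΩ : K ⊆ Ω) :
    ∃ (χ : Euc n → ℝ) (L : Set (Euc n)) (δ : ℝ), ContDiff ℝ ∞ χ ∧ IsCompact L ∧ L ⊆ Ω ∧ 0 < δ ∧
      -- The value `1` is needed on a thickening of `K`: the cutoff will be evaluated at `π x`,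
      -- which for `x ∈ K` is only close to `K`.
      (∀ x ∈ Metric.cthickening δ K, χ x = 1) ∧ ∀ x ∉ L, χ x = 0 := by
  obtain ⟨δ, hδ, hδΩ⟩ := hK.exists_cthickening_subset_open hΩ hKΩ
  obtain ⟨η, hη, hηΩ⟩ := hK.cthickening (r := δ) |>.exists_cthickening_subset_open hΩ hδΩ
  obtain ⟨χ, h0, h1, -⟩ := exists_contMDiffMap_zero_one_of_isClosed (n := ⊤)
    (modelWithCornersSelf ℝ (Euc n)) (Metric.isOpen_thickening
      (δ := η) (E := Metric.cthickening δ K)).isClosed_compl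
    (Metric.isClosed_cthickening (δ := δ) (E := K))
    (Set.disjoint_compl_left_iff_subset.2 (Metric.self_subset_thickening hη _))
  refine ⟨χ, Metric.cthickening η (Metric.cthickening δ K), δ, χ.contMDiff.contDiff,
    hK.cthickening.cthickening, hηΩ, hδ, fun x hx => h1 hx, fun x hx => h0 fun hx' => hx ?_⟩
  exact Metric.thickening_subset_cthickening _ _ hx'

end Cutoff

/-! ### Differentiation on the test spaces. -/

section TestSpace

variable {𝕜 : Type*} [RCLike 𝕜] {n d : ℕ} {S : Set (Euc n)} {ε : Euc n → ℝ} {π : Euc n → Euc n}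
  {U : ℕ → Set (Euc n)} {frame : ℕ → Fin d → Euc n → Euc n} {r : ℕ → ℝ} {ν : ℕ}
  {Ω K X : Set (Euc n)} {x : Euc n} {m : ℤ}

/-- A strong asymptotic expansion amounts to symbol estimates for its remainders. -/
lemma hasStrongExpansion_iff (hX : IsOpen X) {fr : Fin d → Euc n → Euc n} {φ : Euc n → 𝕜}
    (hφ : ContDiffOn ℝ ∞ φ X) {a : ℤ → Euc n × Euc d → 𝕜}
    (ha : ∀ j, ContDiffOn ℝ ∞ (tubeTerm π fr (a j) j) X) :
    HasStrongExpansion X π fr φ m a ↔ ∀ N, m ≤ N → IsSymbol (tubeFilter X π) (rhoCoord π) N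
      (fun x => φ x - ∑ j ∈ Finset.Ico m N, tubeTerm π fr (a j) j x) := by
  have hsm : ∀ N, ContDiffOn ℝ ∞ (fun x => φ x - ∑ j ∈ Finset.Ico m N, tubeTerm π fr (a j) j x) X :=
    fun N => hφ.sub (ContDiffOn.sum fun j _ => ha j)
  have heq : ∀ (α : Fin n → ℕ) N, Set.EqOn
      (multiDeriv α (fun x => φ x - ∑ j ∈ Finset.Ico m N, tubeTerm π fr (a j) j x))
      (fun x => multiDeriv α φ x -
        ∑ j ∈ Finset.Ico m N, multiDeriv α (tubeTerm π fr (a j) j) x) X :=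
    fun α N => multiDeriv_sub_sum hX hφ _ _ (fun j _ => ha j) α
  constructor
  · intro h N hN
    refine IsSymbol.of_multiDeriv hX mem_tubeFilter (hsm N) fun α => ?_
    refine isBigO_tubeFilter.2 ?_
    obtain ⟨C, δ, hδ, hC⟩ := h α N hN
    refine ⟨C, δ, hδ, fun x hx hxδ => ?_⟩
    rw [heq α N hx]
    exact hC x hx hxδ
  · intro h α N hN
    obtain ⟨C, δ, hδ, hC⟩ := isBigO_tubeFilter.1
      ((h N hN).multiDeriv hX mem_tubeFilter (hsm N) α).isBigO
    refine ⟨C, δ, hδ, fun x hx hxδ => ?_⟩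
    have := hC x hx hxδ
    rwa [heq α N hx] at this

lemma eventually_notMem_of_proj (hπ : IsTubularNbhd S ε π) {L : Set (Euc n)} (hL : IsCompact L)
    (hx : x ∈ epsNbhd S ε) (hxL : x ∉ π ⁻¹' L) : ∀ᶠ y in 𝓝 x, π y ∉ L :=
  (hπ.contDiffAt hx).continuousAt.eventually_mem (hL.isClosed.isOpen_compl.mem_nhds hxL)

/-- The coefficients of an expansion of a function vanishing outside `K` may be cut off near
`K`. -/
lemma isSymbol_sub_cutoff (hU : IsTubularCover S ε U frame r) (hπ : IsTubularNbhd S ε π)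
    (hS : IsClosed S) (hΩ : IsOpen Ω) {φ R : Euc n → 𝕜}
    (hRs : ContDiffOn ℝ ∞ (fun x => φ x - R x) ((Ω ∩ U ν) \ S)) {χ : Euc n → ℝ} {L : Set (Euc n)}
    {δ : ℝ} (hχ : ContDiff ℝ ∞ χ) (hL : IsCompact L) (hδ : 0 < δ)
    (hχ1 : ∀ x ∈ Metric.cthickening δ K, χ x = 1) (hχ0 : ∀ x ∉ L, χ x = 0)
    (hφK : ∀ x ∈ Ω \ S, x ∉ K → φ x = 0) {N : ℤ}
    (hR : IsSymbol (tubeFilter ((Ω ∩ U ν) \ S) π) (rhoCoord π) N (fun x => φ x - R x)) :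
    IsSymbol (tubeFilter ((Ω ∩ U ν) \ S) π) (rhoCoord π) N (fun x => φ x - χ (π x) • R x) := by
  have hXW : (Ω ∩ U ν) \ S ⊆ U ν \ S := fun x hx => ⟨hx.1.2, hx.2⟩
  have hXo : IsOpen ((Ω ∩ U ν) \ S) := (hΩ.inter (hU.isOpen ν)).sdiff hS
  have hXN := hXW.trans hU.diff_subset
  have hρ := (hU.eventually_rhoCoord hπ hXW).filter_mono (tubeFilterOver_le (K := L))
  have hχπ : ContDiffOn ℝ ∞ (fun x => χ (π x)) (epsNbhd S ε) := hχ.comp_contDiffOn hπ.smooth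
  have h1 : IsSymbol (tubeFilterOver ((Ω ∩ U ν) \ S) π L) (rhoCoord π) N
      (fun x => χ (π x) • (φ x - R x)) := by
    have := (hπ.isSymbol_zero_of_contDiffOn hS hXN hL hχπ hρ).smul (hρ.mono fun _ h => h.1) hXo
      mem_tubeFilterOver (hχπ.mono hXN) hRs (hR.mono_filter tubeFilterOver_le)
    rwa [zero_add] at this
  have h2 : IsSymbol (tubeFilter ((Ω ∩ U ν) \ S) π) (rhoCoord π) N
      (fun x => χ (π x) • (φ x - R x)) := by
    refine h1.of_inf_principal ?_
    filter_upwards [mem_tubeFilter] with x hx hxL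
    filter_upwards [eventually_notMem_of_proj hπ hL (hXN hx) hxL] with y hy
    simp [hχ0 _ hy]
  refine h2.congr_eventually (eventually_tubeFilter.2 ⟨δ, hδ, fun x hx hxδ => ?_⟩)
  have hnear : ∀ᶠ y in 𝓝 x, rhoCoord π y < δ :=
    ((hU.contDiffOn_rhoCoord hπ).continuousOn.continuousAt
      ((hU.isOpen_diff hS).mem_nhds (hXW hx))).eventually_lt_const hxδ
  filter_upwards [hXo.mem_nhds hx, hnear] with y hy hyδ
  -- On `K` the cutoff at `π y` equals `1`; off `K` the function `φ` vanishes. Either way `χ (φ - R)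
  -- = φ - χ R`.
  by_cases hyK : y ∈ K
  · have : χ (π y) = 1 := by
      refine hχ1 _ (Metric.mem_cthickening_of_dist_le _ y δ _ hyK ?_)
      rw [dist_comm, dist_eq_norm]
      exact hyδ.le
    simp [this]
  · simp [hφK y ⟨hy.1.1, hy.2⟩ hyK]

/-- Rearrangement of a finite triangular double sum. -/
lemma sum_Ico_sum_Ico_eq {M : Type*} [AddCommMonoid M] (m N : ℤ) (T : ℤ → ℕ → M) :
    ∑ q ∈ Finset.Ico (m - 1) N, ∑ j ∈ Finset.Ico m (q + 2), T j (q + 1 - j).toNat =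
      ∑ j ∈ Finset.Ico m (N + 1), ∑ l ∈ Finset.range (N + 1 - j).toNat, T j l := by
  rw [Finset.sum_comm' (t' := Finset.Ico m (N + 1)) (s' := fun j => Finset.Ico (j - 1) N)]
  · refine Finset.sum_congr rfl fun j _ => ?_
    refine Finset.sum_nbij' (fun q => (q + 1 - j).toNat) (fun l => l + j - 1) ?_ ?_ ?_ ?_ ?_
    · intro q hq
      simp only [Finset.mem_Ico, Finset.mem_range] at *
      lia
    · intro q hq
      simp only [Finset.mem_Ico, Finset.mem_range] at *
      lia
    · intro q hq
      simp only [Finset.mem_Ico] at *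
      lia
    · intro q hq
      simp only [Finset.mem_range] at *
      lia
    · intro q hq
      rfl
  · intro q j
    simp only [Finset.mem_Ico]
    lia

/-- A partial derivative lowers the order of the test space by one. -/
lemma partialDeriv_mem_testSpace (hU : IsTubularCover S ε U frame r) (hπ : IsTubularNbhd S ε π)
    (hS : IsClosed S) (hΩ : IsOpen Ω) (hK : IsCompact K) (hKΩ : K ⊆ Ω) {φ : Euc n → 𝕜}
    (hφ : φ ∈ testSpace 𝕜 S Ω π U frame m K) (i : Fin n) :
    partialDeriv i φ ∈ testSpace 𝕜 S Ω π U frame (m - 1) K := by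
  obtain ⟨hφs, hφK, hφe⟩ := hφ
  have hΩS : IsOpen (Ω \ S) := hΩ.sdiff hS
  refine ⟨hφs.partialDeriv hΩS i, fun x hx hxK => ?_, fun ν hν => ?_⟩
  · have h0 : Set.EqOn φ 0 ((Ω \ S) \ K) := fun y hy => hφK y hy.1 hy.2
    rw [h0.partialDeriv (hΩS.sdiff hK.isClosed) i ⟨hx, hxK⟩]
    simp [partialDeriv]
  obtain ⟨a, ha, hexp⟩ := hφe ν hν
  obtain ⟨χ, L, δ, hχ, hL, hLΩ, hδ, hχ1, hχ0⟩ := exists_cutoff hK hΩ hKΩ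
  set X := (Ω ∩ U ν) \ S with hXdef
  have hXW : X ⊆ U ν \ S := fun x hx => ⟨hx.1.2, hx.2⟩
  have hXo : IsOpen X := (hΩ.inter (hU.isOpen ν)).sdiff hS
  have hXN : X ⊆ epsNbhd S ε := hXW.trans hU.diff_subset
  have hWo := hU.isOpen_diff (ν := ν) hS
  have hφX : ContDiffOn ℝ ∞ φ X := hφs.mono fun x hx => ⟨hx.1.1, hx.2⟩
  have hta : ∀ j, ContDiffOn ℝ ∞ (tubeTerm π (frame ν) (a j) j) (U ν \ S) := fun j =>
    contDiffOn_tubeTerm hU hπ hS (ha j) j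
  have hρ := hU.eventually_rhoCoord hπ hXW
  have hR := (hasStrongExpansion_iff hXo hφX fun j => (hta j).mono hXW).1 hexp
  let f : ℤ → Euc n → 𝕜 := fun j x => χ (π x) • tubeTerm π (frame ν) (a j) j x
  have hχπ : ContDiffOn ℝ ∞ (fun x => χ (π x)) (U ν \ S) :=
    hχ.comp_contDiffOn (hπ.smooth.mono hU.diff_subset)
  have hfs : ∀ j, ContDiffOn ℝ ∞ (f j) (U ν \ S) := fun j => hχπ.smul (hta j)
  have hfX : ∀ j, ContDiffOn ℝ ∞ (f j) X := fun j => (hfs j).mono hXW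
  have hfh : ∀ j, IsFiberHomogeneous π (U ν \ S) (r ν) j (f j) := by
    intro j x hx t ht htr
    simp only [f]
    rw [isFiberHomogeneous_tubeTerm hU hπ (a j) j x hx t ht htr, hU.proj_fiberScale hπ hx ht htr,
      smul_comm]
  have hRs : ∀ N, ContDiffOn ℝ ∞ (fun x => φ x - ∑ j ∈ Finset.Ico m N, f j x) X := fun N =>
    hφX.sub (ContDiffOn.sum fun j _ => hfX j)
  have hR' : ∀ N, m ≤ N → IsSymbol (tubeFilter X π) (rhoCoord π) N
      (fun x => φ x - ∑ j ∈ Finset.Ico m N, f j x) := by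
    intro N hN
    have h1 := isSymbol_sub_cutoff hU hπ hS hΩ
      (hφX.sub (ContDiffOn.sum fun j _ => (hta j).mono hXW)) hχ hL hδ hχ1 hχ0 hφK (hR N hN)
    simpa only [Finset.smul_sum] using h1
  -- Each term is the difference of two consecutive remainders. This bounds it uniformly, which
  -- smoothness of `a j` on the relatively open set `S ∩ U ν` would not.
  have hf : ∀ j, m ≤ j → IsSymbol (tubeFilter X π) (rhoCoord π) j (f j) := by
    intro j hj
    have h1 := (hR' j hj).sub hXo mem_tubeFilter (hRs j) (hRs (j + 1))
      ((hR' (j + 1) (by lia)).mono hρ (by lia))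
    refine h1.congr hXo mem_tubeFilter fun x _ => ?_
    rw [← Finset.insert_Ico_right_eq_Ico_add_one hj, Finset.sum_insert (by simp)]
    ring
  let e : Euc n := EuclideanSpace.single i 1
  let T : ℤ → ℕ → Euc n → 𝕜 := fun j l => derivTerm π (f j) e l
  have hTs : ∀ j l, ContDiffOn ℝ ∞ (T j l) (U ν \ S) := fun j l =>
    hπ.contDiffOn_derivTerm hWo hU.diff_subset (hfs j) e l
  -- Gathers the pieces with `j - 1 + l = q`; the condition `l ≥ 0` means `j < q + 2`.
  let H : ℤ → Euc n → 𝕜 := fun q x => ∑ j ∈ Finset.Ico m (q + 2), T j (q + 1 - j).toNat x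
  have hHs : ∀ q, ContDiffOn ℝ ∞ (H q) (U ν \ S) := fun q => ContDiffOn.sum fun j _ => hTs j _
  have hHh : ∀ q, IsFiberHomogeneous π (U ν \ S) (r ν) q (H q) := by
    intro q x hx t ht htr
    simp only [H, Finset.smul_sum]
    refine Finset.sum_congr rfl fun j hj => ?_
    have h1 := isFiberHomogeneous_derivTerm hU hπ hS (hfh j) (hfs j) e (q + 1 - j).toNat
      x hx t ht htr
    rw [Finset.mem_Ico] at hj
    rwa [show j - 1 + ((q + 1 - j).toNat : ℤ) = q by lia] at h1
  choose b hbs hb using fun q => (hHh q).exists_tubeTerm hU hπ hS (hHs q)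
  refine ⟨b, hbs, (hasStrongExpansion_iff hXo (hφX.partialDeriv hXo i)
    fun j => (contDiffOn_tubeTerm hU hπ hS (hbs j) j).mono hXW).2 fun N hN => ?_⟩
  -- Keeping `N + 1 - j` pieces leaves an error of order `j - 1 + (N + 1 - j) = N` for every `j`.
  -- Where `π x ∉ L`, everything vanishes locally.
  have hmain : ∀ j ∈ Finset.Ico m (N + 1), IsSymbol (tubeFilter X π) (rhoCoord π) N
      (fun x => partialDeriv i (f j) x - ∑ l ∈ Finset.range (N + 1 - j).toNat, T j l x) := by
    intro j hj
    rw [Finset.mem_Ico] at hj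
    have h1 := isSymbol_fderiv_sub_sum_derivTerm hU hπ hS hΩ hL hLΩ (hfs j) (hfh j)
      ((hf j hj.1).mono_filter tubeFilterOver_le) e (N + 1 - j).toNat
    rw [show j - 1 + ((N + 1 - j).toNat : ℤ) = N by lia] at h1
    refine h1.of_inf_principal ?_
    filter_upwards [mem_tubeFilter] with x hx hxL
    have hf0 : f j =ᶠ[𝓝 x] 0 := by
      filter_upwards [eventually_notMem_of_proj hπ hL (hXN hx) hxL] with y hy
      simp [f, hχ0 _ hy]
    have hd0 : fderiv ℝ (f j) =ᶠ[𝓝 x] 0 := by simpa using hf0.fderiv (𝕜 := ℝ)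
    have hT0 := (Filter.eventually_all_finset (Finset.range (N + 1 - j).toNat)).2 fun l _ =>
      derivTerm_eventuallyEq_zero (π := π) hf0 e l
    filter_upwards [hd0, hT0] with y hy1 hy2
    rw [hy1, Finset.sum_eq_zero hy2]
    simp
  -- The expansion of `φ` is taken to order `N + 1`, since differentiation costs one order.
  have hN1 := (hR' (N + 1) (by lia)).partialDeriv hXo mem_tubeFilter (hRs (N + 1)) i
  rw [add_sub_cancel_right] at hN1
  have hDs : ∀ j, ContDiffOn ℝ ∞ (fun x => partialDeriv i (f j) x -
      ∑ l ∈ Finset.range (N + 1 - j).toNat, T j l x) X := fun j =>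
    ((hfX j).partialDeriv hXo i).sub (ContDiffOn.sum fun l _ => (hTs j l).mono hXW)
  have hsum := IsSymbol.sum hXo mem_tubeFilter (Finset.Ico m (N + 1)) (fun j _ => hDs j) hmain
  refine (hN1.add hXo mem_tubeFilter ((hRs (N + 1)).partialDeriv hXo i)
    (ContDiffOn.sum fun j _ => hDs j) hsum).congr hXo mem_tubeFilter fun x hx => ?_
  have hp : partialDeriv i (fun x => φ x - ∑ j ∈ Finset.Ico m (N + 1), f j x) x =
      partialDeriv i φ x - ∑ j ∈ Finset.Ico m (N + 1), partialDeriv i (f j) x := by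
    have hd : ∀ g : Euc n → 𝕜, ContDiffOn ℝ ∞ g X → DifferentiableAt ℝ g x := fun g hg =>
      (hg.contDiffAt (hXo.mem_nhds hx)).differentiableAt (by simp)
    unfold partialDeriv
    rw [fderiv_fun_sub (hd _ hφX) (hd _ (ContDiffOn.sum fun j _ => hfX j)),
      fderiv_fun_sum fun j _ => hd _ (hfX j)]
    simp
  have hq : ∑ q ∈ Finset.Ico (m - 1) N, tubeTerm π (frame ν) (b q) q x =
      ∑ j ∈ Finset.Ico m (N + 1), ∑ l ∈ Finset.range (N + 1 - j).toNat, T j l x := by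
    rw [← sum_Ico_sum_Ico_eq m N fun j l => T j l x]
    exact Finset.sum_congr rfl fun q _ => hb q (hXW hx)
  rw [hp, hq, Finset.sum_sub_distrib]
  ring

lemma iterate_partialDeriv_mem_testSpace (hU : IsTubularCover S ε U frame r)
    (hπ : IsTubularNbhd S ε π) (hS : IsClosed S) (hΩ : IsOpen Ω) (hK : IsCompact K) (hKΩ : K ⊆ Ω)
    {φ : Euc n → 𝕜} (hφ : φ ∈ testSpace 𝕜 S Ω π U frame m K) (i : Fin n) (k : ℕ) :
    (partialDeriv i)^[k] φ ∈ testSpace 𝕜 S Ω π U frame (m - k) K := by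
  induction k generalizing φ m with
  | zero => simpa using hφ
  | succ k ih =>
    have := ih (partialDeriv_mem_testSpace hU hπ hS hΩ hK hKΩ hφ i)
    rwa [show m - 1 - (k : ℤ) = m - ((k + 1 : ℕ) : ℤ) by push_cast; ring] at this

lemma multiDeriv_mem_testSpace (hU : IsTubularCover S ε U frame r)
    (hπ : IsTubularNbhd S ε π) (hS : IsClosed S) (hΩ : IsOpen Ω) (hK : IsCompact K) (hKΩ : K ⊆ Ω)
    {φ : Euc n → 𝕜} (hφ : φ ∈ testSpace 𝕜 S Ω π U frame m K) (α : Fin n → ℕ) :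
    multiDeriv α φ ∈ testSpace 𝕜 S Ω π U frame (m - order α) K := by
  have key : ∀ l : List (Fin n), listDeriv l α φ ∈
      testSpace 𝕜 S Ω π U frame (m - (l.map fun i => (α i : ℤ)).sum) K := by
    intro l
    induction l with
    | nil => simpa [listDeriv] using hφ
    | cons j l ih =>
      have := iterate_partialDeriv_mem_testSpace hU hπ hS hΩ hK hKΩ ih j (α j)
      rwa [show m - (l.map fun i => (α i : ℤ)).sum - (α j : ℤ) =
        m - ((j :: l).map fun i => (α i : ℤ)).sum by simp; ring] at this
  have := key (List.finRange n)
  rwa [← Fin.sum_univ_def] at this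

end TestSpace

end Thick

theorem mainTheorem2 {𝕜 : Type*} [RCLike 𝕜] {n k d : ℕ} (hkd : k + d = n)
    (S : Set (Thick.Euc n)) (hS : IsClosed S) (hSk : Thick.IsSubmanifold k S)
    (ε : Thick.Euc n → ℝ) (π : Thick.Euc n → Thick.Euc n) (hπ : Thick.IsTubularNbhd S ε π)
    (U : ℕ → Set (Thick.Euc n)) (frame : ℕ → Fin d → Thick.Euc n → Thick.Euc n) (r : ℕ → ℝ)
    (hU : Thick.IsTubularCover S ε U frame r)
    (Ω : Set (Thick.Euc n)) (hΩ : IsOpen Ω) (hΩS : (Ω ∩ S).Nonempty)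
    (K : Set (Thick.Euc n)) (hK : IsCompact K) (hKΩ : K ⊆ Ω) (m : ℤ) (α : Fin n → ℕ) :
    Set.MapsTo (Thick.multiDeriv (𝕜 := 𝕜) α)
      (Thick.testSpace 𝕜 S Ω π U frame m K)
      (Thick.testSpace 𝕜 S Ω π U frame (m - Thick.order α) K) :=
  fun _ hφ => Thick.multiDeriv_mem_testSpace hU hπ hS hΩ hK hKΩ hφ α
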